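/- Fix a finite alphabet $\Sigma$. $\mathrm{LTL}$ formulas (in negation normal form) over $\Sigma$ are built from $\top$, $\bot$, the letters $c\in\Sigma$ and their negations $\neg c$ by $\wedge$, $\vee$, $\mathbf X$, $\mathbf F$, $\mathbf G$, $\mathbf U$. They are interpreted on non-empty finite words $w=w(1)\cdots w(\ell)$: $w\models c$ iff $w(1)=c$; $w\models\mathbf X\varphi$ iff $\ell>1$ and $w(2)\cdots w(\ell)\models\varphi$; $w\models\mathbf F\varphi$ (resp. $\mathbf G\varphi$) iff $w(i)\cdots w(\ell)\models\varphi$ for some (resp. every) $i\in\{1,\dots,\ell\}$; $w\models\varphi\,\mathbf U\,\psi$ iff for some $i\in\{1,\dots,\ell\}$ we have $w(i)\cdots w(\ell)\models\psi$ and $w(j)\cdots w(\ell)\models\varphi$ for all $1\le j<i$; the Boolean connectives, $\top$, $\bot$ and $\neg c$ are interpreted as usual. The size of a formula is the number of nodes of its syntactic tree (letters, negated letters, $\top$ and $\bot$ being leaves). For a set $Op$ of operators, $\mathrm{LTL}(Op)$ is the set of formulas all of whose operators belong to $Op$. A sample $(P,N)$ consists of finitely many positive words (forming $P$) and finitely many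 negative words (forming $N$), all non-empty; its size $|P|+|N|$ is the sum of the lengths of its words. A formula separates $(P,N)$ if it is satisfied by every word of $P$ and by no word of $N$. Theorem. Let $Op\subseteq\{\mathbf F,\mathbf G,\mathbf X,\wedge,\vee\}$. (1) $Op$ has the short formula property: there is a polynomial $p$, depending only on $Op$, such that for every finite alphabet and every sample $(P,N)$ over it, if some formula of $\mathrm{LTL}(Op)$ separates $(P,N)$, then some formula of $\mathrm{LTL}(Op)$ of size at most $p(|P|+|N|)$ separates $(P,N)$. (2) Consequently, for every fixed finite alphabet, the $\mathrm{LTL}(Op)$ learning problem is in $\mathrm{NP}$: given a sample $(P,N)$ and a number $k\in\mathbb N$ written in binary, decide whether some formula of $\mathrm{LTL}(Op)$ of size at most $k$ separates $(P,N)$. -/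

import Mathlib

/-- The operators that may be allowed in a fragment of `LTL`. -/
inductive Operator
  | untl
  | eventually
  | globally
  | next
  | and
  | or

/-- Formulas of linear temporal logic in negation normal form over the alphabet `A`. -/
inductive LTL (A : Type)
  | top : LTL A
  | bot : LTL A
  | letter (c : A) : LTL A
  | negLetter (c : A) : LTL A
  | and (φ ψ : LTL A) : LTL A
  | or (φ ψ : LTL A) : LTL A
  | next (φ : LTL A) : LTL A
  | eventually (φ : LTL A) : LTL A
  | globally (φ : LTL A) : LTL A
  | untl (φ ψ : LTL A) : LTL A

namespace LTL

variable {A : Type}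

/-- `φ.Sat w` means `w ⊨ φ`. It is meant for non-empty words `w`. Positions are counted from `0`,
so `w.drop i` with `i < w.length` runs through the non-empty suffixes of `w`; only such suffixes
are ever visited when `w` is non-empty. -/
def Sat : LTL A → List A → Prop
  | top, _ => True
  | bot, _ => False
  | letter c, w => w.head? = some c
  | negLetter c, w => w.head? ≠ some c
  | and φ ψ, w => φ.Sat w ∧ ψ.Sat w
  | or φ ψ, w => φ.Sat w ∨ ψ.Sat w
  | next φ, w => 1 < w.length ∧ φ.Sat (w.drop 1)
  | eventually φ, w => ∃ i < w.length, φ.Sat (w.drop i)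
  | globally φ, w => ∀ i < w.length, φ.Sat (w.drop i)
  | untl φ ψ, w => ∃ i < w.length, (∀ j < i, φ.Sat (w.drop j)) ∧ ψ.Sat (w.drop i)

/-- The number of nodes of the syntactic tree, whose leaves are `⊤`, `⊥`, the letters and the
negated letters. -/
def size : LTL A → ℕ
  | top => 1
  | bot => 1
  | letter _ => 1
  | negLetter _ => 1
  | and φ ψ => φ.size + ψ.size + 1
  | or φ ψ => φ.size + ψ.size + 1
  | next φ => φ.size + 1
  | eventually φ => φ.size + 1
  | globally φ => φ.size + 1
  | untl φ ψ => φ.size + ψ.size + 1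

/-- `φ.InFragment Op` means that `φ` is a formula of `LTL(Op)`: every operator that occurs in `φ`
belongs to `Op`. -/
def InFragment (Op : Set Operator) : LTL A → Prop
  | top => True
  | bot => True
  | letter _ => True
  | negLetter _ => True
  | and φ ψ => Operator.and ∈ Op ∧ φ.InFragment Op ∧ ψ.InFragment Op
  | or φ ψ => Operator.or ∈ Op ∧ φ.InFragment Op ∧ ψ.InFragment Op
  | next φ => Operator.next ∈ Op ∧ φ.InFragment Op
  | eventually φ => Operator.eventually ∈ Op ∧ φ.InFragment Op
  | globally φ => Operator.globally ∈ Op ∧ φ.InFragment Op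
  | untl φ ψ => Operator.untl ∈ Op ∧ φ.InFragment Op ∧ ψ.InFragment Op

end LTL

/-- A sample: finitely many positive and finitely many negative words, all of them non-empty. -/
structure Sample (A : Type) where
  pos : List (List A)
  neg : List (List A)
  pos_ne_nil : ∀ u ∈ pos, u ≠ []
  neg_ne_nil : ∀ v ∈ neg, v ≠ []

/-- The symbols used to write an instance of the learning problem as a word. -/
inductive InputSymbol (A : Type)
  | bit (b : Bool) : InputSymbol A
  | posMark : InputSymbol A
  | negMark : InputSymbol A
  | letter (a : A) : InputSymbol A

namespace Sample

variable {A : Type}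

/-- The size `|P| + |N|` of a sample: the sum of the lengths of its words. -/
def size (S : Sample A) : ℕ :=
  (S.pos.map List.length).sum + (S.neg.map List.length).sum

/-- `φ` separates the positive words from the negative words. -/
def Separates (S : Sample A) (φ : LTL A) : Prop :=
  (∀ u ∈ S.pos, φ.Sat u) ∧ ∀ v ∈ S.neg, ¬ φ.Sat v

/-- The instance `((P, N), k)` written as a word: the binary expansion of `k` (least significant
bit first, no superfluous zeros), then the positive words, each preceded by `posMark`, then the
negative words, each preceded by `negMark`. -/
def encode (S : Sample A) (k : ℕ) : List (InputSymbol A) :=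
  k.bits.map InputSymbol.bit
    ++ S.pos.flatMap (fun u => InputSymbol.posMark :: u.map InputSymbol.letter)
    ++ S.neg.flatMap (fun v => InputSymbol.negMark :: v.map InputSymbol.letter)

end Sample

/-- `Op` has the short formula property: some polynomial bounds, in terms of the size of the
sample, the size of some separating formula of `LTL(Op)`, whenever there is one. The polynomial
depends on `Op` only, not on the alphabet. -/
def ShortFormulaProperty (Op : Set Operator) : Prop :=
  ∃ p : Polynomial ℕ, ∀ (A : Type) [Finite A] (S : Sample A),
    (∃ φ : LTL A, φ.InFragment Op ∧ S.Separates φ) →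
      ∃ φ : LTL A, φ.InFragment Op ∧ S.Separates φ ∧ φ.size ≤ p.eval S.size

/-- The `LTL(Op)` learning problem over the fixed alphabet `A`, as a language: the words that
encode a sample and a number `k` (in binary) such that a formula of `LTL(Op)` of size at most `k`
separates the sample. -/
def learningProblem (A : Type) (Op : Set Operator) : Language (InputSymbol A) :=
  {x | ∃ (S : Sample A) (k : ℕ), x = S.encode k ∧
    ∃ φ : LTL A, φ.InFragment Op ∧ φ.size ≤ k ∧ S.Separates φ}

/-- A pair of words over `Γ` and `Δ` written as one word over the disjoint union. -/
def encodePair {Γ Δ : Type} (xy : List Γ × List Δ) : List (Γ ⊕ Δ) :=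
  xy.1.map Sum.inl ++ xy.2.map Sum.inr

/-- The class NP: membership of `x` in `L` is witnessed by a certificate `y`, a word over a finite
alphabet whose length is polynomially bounded in that of `x`, and a multi-stack Turing machine
checks certificates in polynomial time. (Finiteness of all stack alphabets is spelled out, since
the bundled machines only ask for it on the input stack.) -/
def InNP {Γ : Type} (L : Language Γ) : Prop :=
  ∃ (Δ : Type) (_ : Finite Δ) (V : List Γ × List Δ → Bool) (p : Polynomial ℕ)
    (M : Turing.TM2ComputableInPolyTime encodePair Computability.encodeBool V),
    (∀ s, Finite (M.tm.Γ s)) ∧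
      ∀ x : List Γ, x ∈ L ↔ ∃ y : List Δ, y.length ≤ p.eval x.length ∧ V (x, y) = true

/-!
The proof of the short formula property depends on which of `∧` and `∨` are available.

* With both of them, it suffices to separate one positive word `u` from one negative word `v` by
  a short formula: the disjunction over `u` of the conjunctions over `v` of these formulas separates
  the sample. With `X`, a formula `X ⋯ X c` separates the two words at a position where they
  differ, and if `u` is a prefix of `v`, then `X ⋯ X G c` is a candidate. Without `X`, the formula
  `a₁ ∧ F (a₂ ∧ F (a₃ ∧ ⋯))` for `u = a₁ a₂ a₃ ⋯` is the strongest one without `G` that holds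
  for `u`, and the negation of that for `v` is the weakest one without `F` that fails on `v`. If
  these do not separate `u` and `v` where `F` and `G` are available, then the words agree up to
  repetitions of letters, to which formulas without `X` are insensitive
  (`LTL.exists_separating_pair`).
* With `∧` only, a separating formula `φ` is replaced by a conjunction of weakenings, one for each
  negative word. A normal form (`LTL.exists_conjunctive_form`) reduces this to formulas `F φ` that
  fail on a word `v`. At each suffix of `v` a conjunct of `φ` fails, and the conjunction of one
  weakening for each suffix is short (`LTL.exists_weaker_eventually`): a conjunct `X ⋯ X F ψ` that
  fails at one suffix fails at all later ones, so that it is needed at most once.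
* With `∨` only, the roles are exchanged, but not symmetrically, since the dual of `X` is not
  available: `X ⋯ X G ψ` with `k` operators `X` fails at the last `k` suffixes, which need
  strengthenings of their own. The sizes add up to a polynomial all the same
  (`LTL.exists_stronger_globally`).
* With neither, every formula is equivalent to a leaf below a block of operators `X` and one of
  `ε`, `F`, `G`, `F G` (`LTL.exists_isBasic_equivalent`). It is short if it holds for some positive
  word, and otherwise `⊥` separates the sample.

For membership in NP, the certificate is a separating formula in prefix order; the short formula
property bounds its length by a polynomial in the size of the sample, even if `k` is exponential
in the length of its binary expansion. The machine goes through the input from right to left. For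
each letter it evaluates all subformulas at the current position, with the help of a stack, from
their truth values at the next position, which are stored in the cells of the formula. At the mark
in front of a word it compares the truth value of the formula with the mark. Then it goes through
the bits of `k` from the least significant one on, and for each bit `b` it reduces the number `n` of
marked cells to `⌈(n - b) / 2⌉`; since `n ≤ 2 k + b` if and only if `⌈(n - b) / 2⌉ ≤ k`, no marked
cell remains if and only if the formula has at most `k` nodes (`Verifier.verify_eq_true`). Machines
of this shape run in quadratic time (`InNP.of_sweepProgram`).
-/

namespace LTL

variable {A : Type}

/-! ### Derived operators -/

/-- Formulas consisting of a single node. -/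
def IsLeaf : LTL A → Prop
  | top | bot | letter _ | negLetter _ => True
  | _ => False

/-- `nexts k φ` is `X ⋯ X φ`, with `k` operators `X`. -/
def nexts : ℕ → LTL A → LTL A
  | 0, φ => φ
  | k + 1, φ => next (nexts k φ)

/-- The conjunction of a list of formulas. -/
def bigAnd : List (LTL A) → LTL A
  | [] => top
  | φ :: l => and φ (bigAnd l)

/-- The disjunction of a list of formulas. -/
def bigOr : List (LTL A) → LTL A
  | [] => bot
  | φ :: l => or φ (bigOr l)

theorem sat_nexts {k : ℕ} {φ : LTL A} {w : List A} (hw : w ≠ []) :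
    (nexts k φ).Sat w ↔ k < w.length ∧ φ.Sat (w.drop k) := by
  induction k generalizing w with
  | zero => simp [nexts, List.length_pos_iff.2 hw]
  | succ k ih =>
    simp only [nexts, Sat]
    constructor
    · rintro ⟨h1, h2⟩
      have h3 : 0 < (w.drop 1).length := by simpa using h1
      rw [ih (List.length_pos_iff.1 h3)] at h2
      simp only [List.length_drop, List.drop_drop] at h2
      exact ⟨by omega, by simpa [add_comm] using h2.2⟩
    · rintro ⟨h1, h2⟩
      have h3 : 0 < (w.drop 1).length := by rw [List.length_drop]; omega
      refine ⟨by omega, ?_⟩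
      rw [ih (List.length_pos_iff.1 h3)]
      simp only [List.length_drop, List.drop_drop]
      exact ⟨by omega, by simpa [add_comm] using h2⟩

theorem sat_nexts_drop {k i : ℕ} {φ : LTL A} {w : List A} (hi : i < w.length) :
    (nexts k φ).Sat (w.drop i) ↔ i + k < w.length ∧ φ.Sat (w.drop (i + k)) := by
  rw [sat_nexts (by simpa using hi), List.length_drop, List.drop_drop]
  exact and_congr_left fun _ => by omega

theorem size_nexts (k : ℕ) (φ : LTL A) : (nexts k φ).size = φ.size + k := by
  induction k with
  | zero => rfl
  | succ k ih => simp [nexts, size, ih]; omega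

theorem inFragment_nexts {Op : Set Operator} {k : ℕ} {φ : LTL A} :
    (nexts k φ).InFragment Op ↔ (k = 0 ∨ Operator.next ∈ Op) ∧ φ.InFragment Op := by
  induction k with
  | zero => simp [nexts]
  | succ k ih => simp [nexts, InFragment, ih]; tauto

theorem sat_bigAnd {l : List (LTL A)} {w : List A} :
    (bigAnd l).Sat w ↔ ∀ φ ∈ l, φ.Sat w := by
  induction l with
  | nil => simp [bigAnd, Sat]
  | cons φ l ih => simp [bigAnd, Sat, ih]

theorem sat_bigOr {l : List (LTL A)} {w : List A} :
    (bigOr l).Sat w ↔ ∃ φ ∈ l, φ.Sat w := by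
  induction l with
  | nil => simp [bigOr, Sat]
  | cons φ l ih => simp [bigOr, Sat, ih]

theorem size_bigAnd (l : List (LTL A)) :
    (bigAnd l).size = (l.map fun φ => φ.size + 1).sum + 1 := by
  induction l with
  | nil => rfl
  | cons φ l ih => simp [bigAnd, size, ih]; omega

theorem size_bigOr (l : List (LTL A)) :
    (bigOr l).size = (l.map fun φ => φ.size + 1).sum + 1 := by
  induction l with
  | nil => rfl
  | cons φ l ih => simp [bigOr, size, ih]; omega

theorem inFragment_bigAnd {Op : Set Operator} (hOp : Operator.and ∈ Op) {l : List (LTL A)}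
    (hl : ∀ φ ∈ l, φ.InFragment Op) : (bigAnd l).InFragment Op := by
  induction l with
  | nil => trivial
  | cons φ l ih =>
    exact ⟨hOp, hl φ (by simp), ih fun ψ hψ => hl ψ (by simp [hψ])⟩

theorem inFragment_bigOr {Op : Set Operator} (hOp : Operator.or ∈ Op) {l : List (LTL A)}
    (hl : ∀ φ ∈ l, φ.InFragment Op) : (bigOr l).InFragment Op := by
  induction l with
  | nil => trivial
  | cons φ l ih =>
    exact ⟨hOp, hl φ (by simp), ih fun ψ hψ => hl ψ (by simp [hψ])⟩

theorem IsLeaf.inFragment {Op : Set Operator} {φ : LTL A} (h : φ.IsLeaf) : φ.InFragment Op := by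
  cases φ <;> simp_all [IsLeaf, InFragment]

theorem IsLeaf.size_eq {φ : LTL A} (h : φ.IsLeaf) : φ.size = 1 := by
  cases φ <;> simp_all [IsLeaf, size]

theorem exists_lt_length_drop {P : List A → Prop} {i : ℕ} {w : List A} (hi : i < w.length) :
    (∃ j < (w.drop i).length, P ((w.drop i).drop j)) ↔
      ∃ j, i ≤ j ∧ j < w.length ∧ P (w.drop j) := by
  simp only [List.length_drop, List.drop_drop]
  constructor
  · rintro ⟨j, h1, h2⟩
    exact ⟨i + j, by omega, by omega, h2⟩
  · rintro ⟨j, h1, h2, h3⟩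
    exact ⟨j - i, by omega, by rwa [Nat.add_sub_cancel' h1]⟩

theorem sat_eventually_drop {i : ℕ} {φ : LTL A} {w : List A} (hi : i < w.length) :
    (eventually φ).Sat (w.drop i) ↔ ∃ j, i ≤ j ∧ j < w.length ∧ φ.Sat (w.drop j) :=
  exists_lt_length_drop hi

theorem sat_globally_drop {i : ℕ} {φ : LTL A} {w : List A} (hi : i < w.length) :
    (globally φ).Sat (w.drop i) ↔ ∀ j, i ≤ j → j < w.length → φ.Sat (w.drop j) := by
  have := exists_lt_length_drop (P := fun w => ¬ φ.Sat w) hi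
  rw [← not_iff_not] at this
  simp only [not_exists, not_and, not_not] at this
  exact this

theorem sat_globally_last {φ : LTL A} {w : List A} (hw : w ≠ []) (h : (globally φ).Sat w) :
    φ.Sat (w.drop (w.length - 1)) :=
  h _ (Nat.sub_lt (List.length_pos_iff.2 hw) one_pos)

/-- `F G φ` expresses that `φ` holds at the last position. -/
theorem sat_eventually_globally {φ : LTL A} {w : List A} (hw : w ≠ []) :
    (eventually (globally φ)).Sat w ↔ φ.Sat (w.drop (w.length - 1)) := by
  have hpos := List.length_pos_iff.2 hw
  constructor
  · rintro ⟨i, hi, h⟩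
    rw [sat_globally_drop hi] at h
    exact h _ (by omega) (by omega)
  · intro h
    refine ⟨w.length - 1, by omega, ?_⟩
    rw [sat_globally_drop (by omega)]
    intro j h1 h2
    rwa [show j = w.length - 1 by omega]

/-- `G F φ`, too, expresses that `φ` holds at the last position. -/
theorem sat_globally_eventually {φ : LTL A} {w : List A} (hw : w ≠ []) :
    (globally (eventually φ)).Sat w ↔ φ.Sat (w.drop (w.length - 1)) := by
  have hpos := List.length_pos_iff.2 hw
  constructor
  · intro h
    obtain ⟨j, h1, h2, h3⟩ := (sat_eventually_drop (by omega)).1 (h (w.length - 1) (by omega))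
    rwa [show j = w.length - 1 by omega] at h3
  · intro h i hi
    rw [sat_eventually_drop hi]
    exact ⟨_, by omega, by omega, h⟩

/-- A formula `G X φ` fails, since `X φ` fails at the last position. -/
theorem not_sat_globally_nexts {k : ℕ} {φ : LTL A} {w : List A} (hw : w ≠ []) (hk : k ≠ 0) :
    ¬ (globally (nexts k φ)).Sat w := by
  have hpos := List.length_pos_iff.2 hw
  intro h
  have := (sat_nexts_drop (by omega)).1 (sat_globally_last hw h)
  omega

theorem sat_eventually_nexts {k : ℕ} {φ : LTL A} {w : List A} (hw : w ≠ []) :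
    (eventually (nexts k φ)).Sat w ↔ (nexts k (eventually φ)).Sat w := by
  rw [sat_nexts hw]
  constructor
  · rintro ⟨i, hi, h⟩
    rw [sat_nexts_drop hi] at h
    refine ⟨by omega, ?_⟩
    rw [sat_eventually_drop (by omega)]
    exact ⟨_, by omega, h.1, h.2⟩
  · rintro ⟨hk, h⟩
    rw [sat_eventually_drop hk] at h
    obtain ⟨j, h1, h2, h3⟩ := h
    refine ⟨j - k, by omega, ?_⟩
    rw [sat_nexts_drop (by omega), Nat.sub_add_cancel h1]
    exact ⟨h2, h3⟩

theorem sat_eventually_eventually {φ : LTL A} {w : List A} :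
    (eventually (eventually φ)).Sat w ↔ (eventually φ).Sat w := by
  constructor
  · rintro ⟨i, hi, h⟩
    obtain ⟨j, -, h2, h3⟩ := (sat_eventually_drop hi).1 h
    exact ⟨j, h2, h3⟩
  · rintro ⟨i, hi, h⟩
    exact ⟨i, hi, (sat_eventually_drop hi).2 ⟨i, le_rfl, hi, h⟩⟩

theorem sat_globally_globally {φ : LTL A} {w : List A} :
    (globally (globally φ)).Sat w ↔ (globally φ).Sat w := by
  constructor
  · intro h i hi
    exact (sat_globally_drop hi).1 (h i hi) i le_rfl hi
  · intro h i hi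
    exact (sat_globally_drop hi).2 fun j _ hj => h j hj

/-- `φ` and `ψ` hold for the same non-empty words. -/
def Equivalent (φ ψ : LTL A) : Prop :=
  ∀ w : List A, w ≠ [] → (φ.Sat w ↔ ψ.Sat w)

theorem Equivalent.eventually {φ ψ : LTL A} (h : Equivalent φ ψ) :
    Equivalent (eventually φ) (eventually ψ) := fun _ _ =>
  exists_congr fun _ => and_congr_right fun hi => h _ (by simpa using hi)

theorem Equivalent.globally {φ ψ : LTL A} (h : Equivalent φ ψ) :
    Equivalent (globally φ) (globally ψ) := fun _ _ =>
  forall_congr' fun _ => forall_congr' fun hi => h _ (by simpa using hi)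

theorem Equivalent.next {φ ψ : LTL A} (h : Equivalent φ ψ) :
    Equivalent (next φ) (next ψ) := fun _ _ =>
  and_congr_right fun hi => h _ (List.length_pos_iff.1 (by simpa using hi))

theorem Equivalent.nexts {φ ψ : LTL A} (h : Equivalent φ ψ) (k : ℕ) :
    Equivalent (nexts k φ) (nexts k ψ) := by
  induction k with
  | zero => exact h
  | succ k ih => exact ih.next

theorem Equivalent.trans {φ ψ χ : LTL A} (h : Equivalent φ ψ) (h' : Equivalent ψ χ) :
    Equivalent φ χ := fun w hw => (h w hw).trans (h' w hw)

/-! ### Basic formulas -/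

/-- Basic formulas are a leaf below a block of operators `X` and one of the blocks `ε`, `F`, `G`
and `F G`. -/
def IsBasic (φ : LTL A) : Prop :=
  ∃ (k : ℕ) (c : LTL A), c.IsLeaf ∧
    (φ = nexts k c ∨ φ = nexts k (eventually c) ∨ φ = nexts k (globally c) ∨
      φ = nexts k (eventually (globally c)))

theorem IsLeaf.isBasic {φ : LTL A} (h : φ.IsLeaf) : φ.IsBasic :=
  ⟨0, φ, h, Or.inl rfl⟩

theorem isBasic_top : (top : LTL A).IsBasic := IsLeaf.isBasic trivial

theorem isBasic_bot : (bot : LTL A).IsBasic := IsLeaf.isBasic trivial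

theorem isBasic_letter {c : A} : (letter c).IsBasic := IsLeaf.isBasic trivial

theorem isBasic_negLetter {c : A} : (negLetter c).IsBasic := IsLeaf.isBasic trivial

theorem IsBasic.next {φ : LTL A} (h : φ.IsBasic) : φ.next.IsBasic := by
  obtain ⟨k, c, hc, h⟩ := h
  refine ⟨k + 1, c, hc, ?_⟩
  rcases h with rfl | rfl | rfl | rfl <;> simp [nexts]

theorem IsBasic.exists_eventually {Op : Set Operator} {φ : LTL A} (h : φ.IsBasic)
    (hφ : φ.eventually.InFragment Op) :
    ∃ ψ : LTL A, ψ.IsBasic ∧ ψ.InFragment Op ∧ Equivalent φ.eventually ψ := by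
  obtain ⟨k, c, hc, h⟩ := h
  rcases h with rfl | rfl | rfl | rfl <;>
    simp only [InFragment, inFragment_nexts] at hφ
  · exact ⟨nexts k (eventually c), ⟨k, c, hc, by simp⟩,
      by simp only [InFragment, inFragment_nexts]; tauto, fun w hw => sat_eventually_nexts hw⟩
  · refine ⟨nexts k (eventually c), ⟨k, c, hc, by simp⟩,
      by simp only [InFragment, inFragment_nexts]; tauto, fun w hw => ?_⟩
    rw [sat_eventually_nexts hw]
    exact Equivalent.nexts (fun _ _ => sat_eventually_eventually) k w hw
  · exact ⟨nexts k (eventually (globally c)), ⟨k, c, hc, by simp⟩,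
      by simp only [InFragment, inFragment_nexts]; tauto, fun w hw => sat_eventually_nexts hw⟩
  · refine ⟨nexts k (eventually (globally c)), ⟨k, c, hc, by simp⟩,
      by simp only [InFragment, inFragment_nexts]; tauto, fun w hw => ?_⟩
    rw [sat_eventually_nexts hw]
    exact Equivalent.nexts (fun _ _ => sat_eventually_eventually) k w hw

theorem IsBasic.exists_globally {Op : Set Operator} {φ : LTL A} (h : φ.IsBasic)
    (hφ : φ.globally.InFragment Op) :
    ∃ ψ : LTL A, ψ.IsBasic ∧ ψ.InFragment Op ∧ Equivalent φ.globally ψ := by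
  obtain ⟨k, c, hc, h⟩ := h
  rcases Nat.eq_zero_or_pos k with rfl | hk
  · rcases h with rfl | rfl | rfl | rfl <;> simp only [InFragment, nexts] at hφ
    · exact ⟨globally φ, ⟨0, φ, hc, by simp [nexts]⟩, hφ, fun _ _ => Iff.rfl⟩
    · refine ⟨eventually (globally c), ⟨0, c, hc, by simp [nexts]⟩,
        by simp only [InFragment]; tauto, fun w hw => ?_⟩
      exact (sat_globally_eventually hw).trans (sat_eventually_globally hw).symm
    · exact ⟨globally c, ⟨0, c, hc, by simp [nexts]⟩, hφ.2, fun _ _ => sat_globally_globally⟩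
    · refine ⟨eventually (globally c), ⟨0, c, hc, by simp [nexts]⟩,
        by simp only [InFragment]; tauto, fun w hw => ?_⟩
      refine (sat_globally_eventually hw).trans (Iff.trans ?_ (sat_eventually_globally hw).symm)
      have hpos := List.length_pos_iff.2 hw
      rw [sat_globally_drop (by omega)]
      refine ⟨fun h => h _ le_rfl (by omega), fun h j h1 h2 => ?_⟩
      rwa [show j = w.length - 1 by omega]
  · refine ⟨bot, isBasic_bot, trivial, fun w hw => iff_of_false ?_ id⟩
    rcases h with rfl | rfl | rfl | rfl <;> exact not_sat_globally_nexts hw hk.ne'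

theorem IsBasic.exists_nexts {φ : LTL A} (h : φ.IsBasic) :
    ∃ (k : ℕ) (ψ : LTL A), φ = nexts k ψ ∧ ψ.size ≤ 3 := by
  obtain ⟨k, c, hc, h⟩ := h
  rcases h with rfl | rfl | rfl | rfl <;>
    exact ⟨k, _, rfl, by simp [size, hc.size_eq]⟩

theorem IsBasic.size_le_of_sat {φ : LTL A} (h : φ.IsBasic) {w : List A} (hw : w ≠ [])
    (hsat : φ.Sat w) : φ.size ≤ w.length + 2 := by
  obtain ⟨k, ψ, rfl, hψ⟩ := h.exists_nexts
  rw [sat_nexts hw] at hsat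
  rw [size_nexts]
  omega

/-- The weakening replaces a block of operators `X` that leaves the word by a shorter one. -/
theorem IsBasic.exists_weaker {Op : Set Operator} {φ : LTL A} (h : φ.IsBasic)
    (hφ : φ.InFragment Op) {n : ℕ} (hn : 0 < n) :
    ∃ ψ : LTL A, ψ.InFragment Op ∧ ψ.size ≤ n + 2 ∧ (∀ w, w ≠ [] → φ.Sat w → ψ.Sat w) ∧
      ∀ w : List A, w ≠ [] → w.length ≤ n → ¬ φ.Sat w → ¬ ψ.Sat w := by
  obtain ⟨k, ψ, rfl, hψ⟩ := h.exists_nexts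
  rw [inFragment_nexts] at hφ
  rcases lt_or_ge k n with hk | hk
  · exact ⟨nexts k ψ, inFragment_nexts.2 hφ, by rw [size_nexts]; omega, fun _ _ => id,
      fun _ _ _ => id⟩
  · refine ⟨nexts n top, inFragment_nexts.2 ⟨Or.inr (hφ.1.resolve_left (by omega)), trivial⟩,
      by rw [size_nexts, size]; omega, fun w hw hsat => ?_, fun w hw hlen _ => ?_⟩
    · rw [sat_nexts hw] at hsat ⊢
      exact ⟨by omega, trivial⟩
    · rw [sat_nexts hw]
      omega


/-- Without conjunctions, disjunctions and `U`, every formula is equivalent to a basic one. -/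
theorem exists_isBasic_equivalent {Op : Set Operator} (hand : Operator.and ∉ Op)
    (hor : Operator.or ∉ Op) (huntl : Operator.untl ∉ Op) {φ : LTL A} (hφ : φ.InFragment Op) :
    ∃ ψ : LTL A, ψ.IsBasic ∧ ψ.InFragment Op ∧ Equivalent φ ψ := by
  induction φ with
  | top => exact ⟨top, isBasic_top, trivial, fun _ _ => Iff.rfl⟩
  | bot => exact ⟨bot, isBasic_bot, trivial, fun _ _ => Iff.rfl⟩
  | letter c => exact ⟨letter c, isBasic_letter, trivial, fun _ _ => Iff.rfl⟩
  | negLetter c => exact ⟨negLetter c, isBasic_negLetter, trivial, fun _ _ => Iff.rfl⟩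
  | and φ ψ => exact absurd hφ.1 hand
  | or φ ψ => exact absurd hφ.1 hor
  | untl φ ψ => exact absurd hφ.1 huntl
  | next φ ih =>
    obtain ⟨ψ, h1, h2, h3⟩ := ih hφ.2
    exact ⟨ψ.next, h1.next, ⟨hφ.1, h2⟩, h3.next⟩
  | eventually φ ih =>
    obtain ⟨ψ, h1, h2, h3⟩ := ih hφ.2
    obtain ⟨χ, h4, h5, h6⟩ := h1.exists_eventually (Op := Op) ⟨hφ.1, h2⟩
    exact ⟨χ, h4, h5, h3.eventually.trans h6⟩
  | globally φ ih =>
    obtain ⟨ψ, h1, h2, h3⟩ := ih hφ.2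
    obtain ⟨χ, h4, h5, h6⟩ := h1.exists_globally (Op := Op) ⟨hφ.1, h2⟩
    exact ⟨χ, h4, h5, h3.globally.trans h6⟩

theorem sat_eventually_of_length_eq_one {φ : LTL A} {w : List A} (hw : w.length = 1) :
    (eventually φ).Sat w ↔ φ.Sat w := by
  simp [Sat, hw]

theorem sat_globally_of_length_eq_one {φ : LTL A} {w : List A} (hw : w.length = 1) :
    (globally φ).Sat w ↔ φ.Sat w := by
  simp [Sat, hw]

theorem length_drop_length_sub_one {w : List A} (hw : w ≠ []) :
    (w.drop (w.length - 1)).length = 1 := by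
  have := List.length_pos_iff.2 hw
  simp; omega

/-! ### Conjunction without disjunction -/

/-- On words with one letter, a formula without disjunctions is a conjunction of leaves. -/
theorem exists_leaves_forall {Op : Set Operator} (hor : Operator.or ∉ Op)
    (huntl : Operator.untl ∉ Op) {φ : LTL A} (hφ : φ.InFragment Op) :
    ∃ L : List (LTL A), (∀ c ∈ L, c.IsLeaf) ∧
      ∀ w : List A, w.length = 1 → (φ.Sat w ↔ ∀ c ∈ L, c.Sat w) := by
  induction φ with
  | top => exact ⟨[top], by simp [IsLeaf], by simp⟩
  | bot => exact ⟨[bot], by simp [IsLeaf], by simp⟩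
  | letter c => exact ⟨[letter c], by simp [IsLeaf], by simp⟩
  | negLetter c => exact ⟨[negLetter c], by simp [IsLeaf], by simp⟩
  | or φ ψ => exact absurd hφ.1 hor
  | untl φ ψ => exact absurd hφ.1 huntl
  | and φ ψ ih1 ih2 =>
    obtain ⟨L, hL, h1⟩ := ih1 hφ.2.1
    obtain ⟨M, hM, h2⟩ := ih2 hφ.2.2
    refine ⟨L ++ M, ?_, fun w hw => ?_⟩
    · simp only [List.mem_append]
      rintro c (h | h)
      exacts [hL c h, hM c h]
    · simp only [Sat, h1 w hw, h2 w hw, List.mem_append, or_imp, forall_and]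
  | next φ => exact ⟨[bot], by simp [IsLeaf], fun w hw => by simp [Sat, hw]⟩
  | eventually φ ih =>
    obtain ⟨L, hL, h⟩ := ih hφ.2
    exact ⟨L, hL, fun w hw => (sat_eventually_of_length_eq_one hw).trans (h w hw)⟩
  | globally φ ih =>
    obtain ⟨L, hL, h⟩ := ih hφ.2
    exact ⟨L, hL, fun w hw => (sat_globally_of_length_eq_one hw).trans (h w hw)⟩

/-- Without disjunctions, every formula is a conjunction of basic formulas and of formulas
`X ⋯ X F ψ`: the operators `X` and `G` distribute over conjunctions, `X` commutes with `F`,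
formulas `G X ψ` fail, and `G F ψ` speaks of the last letter only. -/
theorem exists_conjunctive_form {Op : Set Operator} (hor : Operator.or ∉ Op)
    (huntl : Operator.untl ∉ Op) {φ : LTL A} (hφ : φ.InFragment Op) :
    ∃ (L : List (LTL A)) (M : List (ℕ × LTL A)),
      (∀ ψ ∈ L, ψ.IsBasic ∧ ψ.InFragment Op) ∧
      (∀ p ∈ M, (nexts p.1 (eventually p.2)).InFragment Op ∧ p.2.size < φ.size) ∧
      ∀ w, w ≠ [] →
        (φ.Sat w ↔ (∀ ψ ∈ L, ψ.Sat w) ∧ ∀ p ∈ M, (nexts p.1 (eventually p.2)).Sat w) := by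
  induction φ with
  | top => exact ⟨[top], [], by simp [isBasic_top, InFragment], by simp, by simp⟩
  | bot => exact ⟨[bot], [], by simp [isBasic_bot, InFragment], by simp, by simp⟩
  | letter c =>
    exact ⟨[letter c], [], by simp [isBasic_letter, InFragment], by simp, by simp⟩
  | negLetter c =>
    exact ⟨[negLetter c], [], by simp [isBasic_negLetter, InFragment], by simp, by simp⟩
  | or φ ψ => exact absurd hφ.1 hor
  | untl φ ψ => exact absurd hφ.1 huntl
  | and φ ψ ih1 ih2 =>
    obtain ⟨L, M, hL, hM, h1⟩ := ih1 hφ.2.1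
    obtain ⟨L', M', hL', hM', h2⟩ := ih2 hφ.2.2
    refine ⟨L ++ L', M ++ M', ?_, ?_, fun w hw => ?_⟩
    · simp only [List.mem_append]
      rintro c (h | h)
      exacts [hL c h, hL' c h]
    · simp only [List.mem_append, size]
      rintro p (h | h)
      · exact ⟨(hM p h).1, by have := (hM p h).2; omega⟩
      · exact ⟨(hM' p h).1, by have := (hM' p h).2; omega⟩
    · simp only [Sat, h1 w hw, h2 w hw, List.mem_append, or_imp, forall_and]
      tauto
  | next φ ih =>
    obtain ⟨L, M, hL, hM, h⟩ := ih hφ.2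
    refine ⟨next top :: L.map next, M.map fun p => (p.1 + 1, p.2), ?_, ?_, fun w hw => ?_⟩
    · simp only [List.mem_cons, List.mem_map]
      rintro _ (rfl | ⟨ψ, hψ, rfl⟩)
      · exact ⟨isBasic_top.next, hφ.1, trivial⟩
      · exact ⟨(hL ψ hψ).1.next, hφ.1, (hL ψ hψ).2⟩
    · simp only [List.mem_map]
      rintro _ ⟨p, hp, rfl⟩
      exact ⟨⟨hφ.1, (hM p hp).1⟩, (hM p hp).2.trans (Nat.lt_succ_self _)⟩
    · simp only [List.forall_mem_cons, List.forall_mem_map, nexts, Sat]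
      by_cases hlen : 1 < w.length
      · have := h (w.drop 1) (List.length_pos_iff.1 (by simpa using hlen))
        simp only [List.drop_one] at this ⊢
        simp [hlen, this]
      · simp [hlen]
  | eventually φ ih =>
    exact ⟨[], [(0, φ)], by simp, by simp [nexts, hφ, size], by simp [nexts]⟩
  | globally φ ih =>
    obtain ⟨L, M, hL, hM, h⟩ := ih hφ.2
    -- The conjunctive forms of the formulas `G ψ` for `ψ ∈ L` and `G X ⋯ X F ψ` for `ψ ∈ M`.
    have h1 : ∀ ψ ∈ L, ∃ χ : LTL A, χ.IsBasic ∧ χ.InFragment Op ∧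
        Equivalent ψ.globally χ := fun ψ hψ =>
      (hL ψ hψ).1.exists_globally ⟨hφ.1, (hL ψ hψ).2⟩
    have h2 : ∀ p ∈ M, ∃ K : List (LTL A), (∀ ψ ∈ K, ψ.IsBasic ∧ ψ.InFragment Op) ∧
        ∀ w, w ≠ [] → ((globally (nexts p.1 (eventually p.2))).Sat w ↔ ∀ ψ ∈ K, ψ.Sat w) := by
      intro p hp
      have hfrag := inFragment_nexts.1 (hM p hp).1
      by_cases hk : p.1 = 0
      · obtain ⟨C, hC, h2⟩ := exists_leaves_forall hor huntl hfrag.2.2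
        refine ⟨C.map fun c => eventually (globally c), ?_, fun w hw => ?_⟩
        · simp only [List.forall_mem_map]
          exact fun c hc => ⟨⟨0, c, hC c hc, by simp [nexts]⟩,
            hfrag.2.1, hφ.1, (hC c hc).inFragment⟩
        · simp only [List.forall_mem_map, hk, nexts, sat_globally_eventually hw,
            sat_eventually_globally hw]
          exact h2 _ (length_drop_length_sub_one hw)
      · refine ⟨[bot], by simp [isBasic_bot, InFragment], fun w hw => ?_⟩
        rw [List.forall_mem_singleton]
        exact iff_of_false (not_sat_globally_nexts hw hk) id
    choose! f hf using h1
    choose! g hg using h2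
    refine ⟨L.map f ++ M.flatMap g, [], ?_, by simp, fun w hw => ?_⟩
    · simp only [List.mem_append, List.mem_map, List.mem_flatMap]
      rintro _ (⟨ψ, hψ, rfl⟩ | ⟨p, hp, hψ⟩)
      · exact ⟨(hf ψ hψ).1, (hf ψ hψ).2.1⟩
      · exact (hg p hp).1 _ hψ
    · have e1 : (globally φ).Sat w ↔ (∀ ψ ∈ L, (globally ψ).Sat w) ∧
          ∀ p ∈ M, (globally (nexts p.1 (eventually p.2))).Sat w := by
        constructor
        · intro hG
          have := fun i (hi : i < w.length) => (h (w.drop i) (by simpa using hi)).1 (hG i hi)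
          exact ⟨fun ψ hψ i hi => (this i hi).1 ψ hψ, fun p hp i hi => (this i hi).2 p hp⟩
        · rintro ⟨hG1, hG2⟩ i hi
          exact (h (w.drop i) (by simpa using hi)).2
            ⟨fun ψ hψ => hG1 ψ hψ i hi, fun p hp => hG2 p hp i hi⟩
      rw [e1]
      simp only [List.mem_append, List.mem_flatMap, or_imp, forall_and,
        List.forall_mem_map, List.not_mem_nil, false_imp_iff, implies_true, and_true]
      refine and_congr (forall₂_congr fun ψ hψ => (hf ψ hψ).2.2 w hw) ?_
      refine Iff.trans (forall₂_congr fun p hp => (hg p hp).2 w hw) ?_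
      exact ⟨fun H ψ ⟨p, hp, hψ⟩ => H p hp ψ hψ, fun H p hp ψ hψ => H ψ ⟨p, hp, hψ⟩⟩

/-- Without disjunctions, a formula `F φ` that fails on `v` has a short weakening that fails on
`v`. At each suffix of `v` one conjunct of `φ` fails. If it is some `X ⋯ X F ψ`, it also fails at
all later suffixes, and `ψ` is weakened with respect to a shorter word. -/
theorem exists_weaker_eventually {Op : Set Operator} (hand : Operator.and ∈ Op)
    (hor : Operator.or ∉ Op) (huntl : Operator.untl ∉ Op) (n : ℕ) :
    ∀ (φ : LTL A), φ.InFragment Op → ∀ v : List A, v.length = n → v ≠ [] →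
      ¬ (eventually φ).Sat v →
      ∃ ψ : LTL A, ψ.InFragment Op ∧ ψ.size ≤ n * (n + 5) ^ 2 ∧
        (∀ w, w ≠ [] → (eventually φ).Sat w → (eventually ψ).Sat w) ∧
        ¬ (eventually ψ).Sat v := by
  induction n using Nat.strong_induction_on with
  | _ n ihn =>
  intro φ
  induction hs : φ.size using Nat.strong_induction_on generalizing φ with
  | _ s ihs =>
  subst hs
  intro hφ v hlen hv hsat
  have hn : 0 < n := hlen ▸ List.length_pos_iff.2 hv
  obtain ⟨L, M, hL, hM, hform⟩ := exists_conjunctive_form hor huntl hφ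
  by_cases hzero : ∃ p ∈ M, p.1 = 0 ∧ ¬ (eventually p.2).Sat v
  · -- `F φ` implies `F p.2`, and `p.2` is a smaller formula.
    obtain ⟨p, hp, hk, hpv⟩ := hzero
    have hfrag := inFragment_nexts.1 (hM p hp).1
    obtain ⟨ψ, h1, h2, h3, h4⟩ := ihs _ (hM p hp).2 p.2 rfl hfrag.2.2 v hlen hv hpv
    refine ⟨ψ, h1, h2, fun w hw hsat => h3 w hw ?_, h4⟩
    obtain ⟨i, hi, h⟩ := hsat
    have := ((hform (w.drop i) (by simpa using hi)).1 h).2 p hp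
    rw [hk, nexts, sat_eventually_drop hi] at this
    obtain ⟨j, -, h5, h6⟩ := this
    exact ⟨j, h5, h6⟩
  -- The last `j` suffixes of `v` are refuted by a list `K` of weakenings of `φ`.
  have cover : ∀ j ≤ n, ∃ K : List (LTL A),
      (∀ ψ ∈ K, ψ.InFragment Op ∧ ∀ w, w ≠ [] → φ.Sat w → ψ.Sat w) ∧
      (∀ i, n - j ≤ i → i < n → ∃ ψ ∈ K, ¬ ψ.Sat (v.drop i)) ∧
      (K.map fun ψ => ψ.size + 1).sum ≤ j * (n + 3) + ((n - 1) * (n + 4) ^ 2 + n + 2) := by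
    intro j hj
    induction j with
    | zero => exact ⟨[], by simp, by intro i; omega, by simp⟩
    | succ j ihj =>
      have hp : n - (j + 1) < v.length := by omega
      have hne : v.drop (n - (j + 1)) ≠ [] := by simpa using hp
      have hfail : ¬ φ.Sat (v.drop (n - (j + 1))) := fun h => hsat ⟨_, hp, h⟩
      rw [hform _ hne, not_and_or] at hfail
      rcases hfail with hfail | hfail <;> push Not at hfail
      · obtain ⟨ψ, hψ, hψv⟩ := hfail
        obtain ⟨χ, h1, h2, h3, h4⟩ := (hL ψ hψ).1.exists_weaker (hL ψ hψ).2 hn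
        obtain ⟨K, hK1, hK2, hK3⟩ := ihj (by omega)
        refine ⟨χ :: K, ?_, fun i h5 h6 => ?_, ?_⟩
        · rw [List.forall_mem_cons]
          exact ⟨⟨h1, fun w hw h => h3 w hw (((hform w hw).1 h).1 ψ hψ)⟩, hK1⟩
        · rcases Nat.eq_or_lt_of_le h5 with rfl | h5
          · exact ⟨χ, by simp, h4 _ hne (by simp; omega) hψv⟩
          · obtain ⟨θ, h7, h8⟩ := hK2 i (by omega) h6
            exact ⟨θ, by simp [h7], h8⟩
        · simp only [List.map_cons, List.sum_cons]
          linarith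
      · obtain ⟨⟨k, ψ⟩, hψ, hψv⟩ := hfail
        simp only at hψv
        have hfrag := inFragment_nexts.1 (hM _ hψ).1
        have himp : ∀ w, w ≠ [] → φ.Sat w → (nexts k (eventually ψ)).Sat w :=
          fun w hw h => ((hform w hw).1 h).2 _ hψ
        rw [sat_nexts_drop hp, not_and] at hψv
        -- One weakening refutes all the suffixes.
        suffices ∃ χ : LTL A, χ.InFragment Op ∧ (∀ w, w ≠ [] → φ.Sat w → χ.Sat w) ∧
            (∀ i, n - (j + 1) ≤ i → i < n → ¬ χ.Sat (v.drop i)) ∧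
            χ.size ≤ (n - 1) * (n + 4) ^ 2 + n + 1 by
          obtain ⟨χ, h1, h2, h3, h4⟩ := this
          refine ⟨[χ], by simpa using ⟨h1, h2⟩, fun i h5 h6 => ⟨χ, by simp, h3 i h5 h6⟩, ?_⟩
          simp only [List.map_cons, List.sum_cons, List.map_nil, List.sum_nil]
          omega
        by_cases hlt : n - (j + 1) + k < n
        · have hpos : 0 < n - (j + 1) + k := by
            by_contra h0
            refine hzero ⟨_, hψ, by simp only; omega, ?_⟩
            have := hψv (by omega)
            rwa [show n - (j + 1) + k = 0 by omega, List.drop_zero] at this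
          set q := n - (j + 1) + k with hq
          have hlen' : (v.drop q).length = n - q := by rw [List.length_drop, hlen]
          obtain ⟨χ, h1, h2, h3, h4⟩ := ihn (n - q) (by omega) ψ hfrag.2.2 (v.drop q) hlen'
            (List.length_pos_iff.1 (by omega)) (hψv (by omega))
          refine ⟨nexts k (eventually χ), inFragment_nexts.2 ⟨hfrag.1, hfrag.2.1, h1⟩,
            fun w hw h => ?_, fun i h5 h6 h7 => ?_, ?_⟩
          · have := himp w hw h
            rw [sat_nexts hw] at this ⊢
            exact ⟨this.1, h3 _ (by simpa using this.1) this.2⟩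
          · rw [sat_nexts_drop (by omega)] at h7
            obtain ⟨h8, h9⟩ := h7
            rw [sat_eventually_drop (by omega)] at h9
            obtain ⟨r, h10, h11, h12⟩ := h9
            exact h4 ((sat_eventually_drop (by omega)).2 ⟨r, by omega, h11, h12⟩)
          · rw [size_nexts, size]
            have : (n - q) * (n - q + 5) ^ 2 ≤ (n - 1) * (n + 4) ^ 2 :=
              Nat.mul_le_mul (by omega) (Nat.pow_le_pow_left (by omega) 2)
            omega
        · refine ⟨nexts (min k n) top, inFragment_nexts.2 ⟨Or.inr (hfrag.1.resolve_left (by omega)),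
            trivial⟩, fun w hw h => ?_, fun i h5 h6 h7 => ?_, ?_⟩
          · have := himp w hw h
            rw [sat_nexts hw] at this ⊢
            exact ⟨by omega, trivial⟩
          · rw [sat_nexts_drop (by omega)] at h7
            omega
          · rw [size_nexts, size]
            omega
  obtain ⟨K, hK1, hK2, hK3⟩ := cover n le_rfl
  refine ⟨bigAnd K, inFragment_bigAnd hand fun ψ hψ => (hK1 ψ hψ).1, ?_, ?_, ?_⟩
  · rw [size_bigAnd]
    obtain ⟨m, rfl⟩ : ∃ m, n = m + 1 := ⟨n - 1, by omega⟩
    simp only [Nat.add_sub_cancel] at hK3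
    nlinarith
  · rintro w - ⟨i, hi, h⟩
    exact ⟨i, hi, sat_bigAnd.2 fun ψ hψ => (hK1 ψ hψ).2 _ (by simpa using hi) h⟩
  · rintro ⟨i, hi, h⟩
    obtain ⟨ψ, h1, h2⟩ := hK2 i (by omega) (by omega)
    exact h2 (sat_bigAnd.1 h ψ h1)

/-- Without disjunctions, a formula that fails on `v` has a short weakening that fails on `v`. -/
theorem exists_weaker {Op : Set Operator} (hand : Operator.and ∈ Op) (hor : Operator.or ∉ Op)
    (huntl : Operator.untl ∉ Op) {φ : LTL A} (hφ : φ.InFragment Op) {v : List A} (hv : v ≠ [])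
    (hsat : ¬ φ.Sat v) :
    ∃ ψ : LTL A, ψ.InFragment Op ∧ ψ.size ≤ (v.length + 5) ^ 3 ∧
      (∀ w, w ≠ [] → φ.Sat w → ψ.Sat w) ∧ ¬ ψ.Sat v := by
  have hn : 0 < v.length := List.length_pos_iff.2 hv
  have hpow : v.length + 5 ≤ (v.length + 5) ^ 3 := Nat.le_self_pow (by norm_num) _
  obtain ⟨L, M, hL, hM, hform⟩ := exists_conjunctive_form hor huntl hφ
  rw [hform v hv, not_and_or] at hsat
  rcases hsat with hsat | hsat <;> push Not at hsat
  · obtain ⟨ψ, hψ, hψv⟩ := hsat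
    obtain ⟨χ, h1, h2, h3, h4⟩ := (hL ψ hψ).1.exists_weaker (hL ψ hψ).2 hn
    exact ⟨χ, h1, by omega, fun w hw h => h3 w hw (((hform w hw).1 h).1 ψ hψ),
      h4 v hv le_rfl hψv⟩
  · obtain ⟨⟨k, ψ⟩, hψ, hψv⟩ := hsat
    simp only at hψv
    have hfrag := inFragment_nexts.1 (hM _ hψ).1
    have himp : ∀ w, w ≠ [] → φ.Sat w → (nexts k (eventually ψ)).Sat w :=
      fun w hw h => ((hform w hw).1 h).2 _ hψ
    rw [sat_nexts hv, not_and] at hψv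
    by_cases hlt : k < v.length
    · have hlen' : (v.drop k).length = v.length - k := by simp
      obtain ⟨χ, h1, h2, h3, h4⟩ := exists_weaker_eventually hand hor huntl _ ψ hfrag.2.2
        (v.drop k) hlen' (List.length_pos_iff.1 (by omega)) (hψv hlt)
      refine ⟨nexts k (eventually χ), inFragment_nexts.2 ⟨hfrag.1, hfrag.2.1, h1⟩, ?_,
        fun w hw h => ?_, fun h => ?_⟩
      · rw [size_nexts, size]
        have : (v.length - k) * (v.length - k + 5) ^ 2 ≤ v.length * (v.length + 5) ^ 2 := by
          gcongr <;> omega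
        nlinarith
      · have := himp w hw h
        rw [sat_nexts hw] at this ⊢
        exact ⟨this.1, h3 _ (by simpa using this.1) this.2⟩
      · rw [sat_nexts hv] at h
        exact h4 h.2
    · refine ⟨nexts v.length top, inFragment_nexts.2 ⟨Or.inr (hfrag.1.resolve_left (by omega)),
        trivial⟩, ?_, fun w hw h => ?_, fun h => ?_⟩
      · rw [size_nexts, size]
        omega
      · have := himp w hw h
        rw [sat_nexts hw] at this ⊢
        exact ⟨by omega, trivial⟩
      · rw [sat_nexts hv] at h
        omega


/-! ### Disjunction without conjunction -/

theorem exists_mem_map {α β : Type*} {f : α → β} {l : List α} {P : β → Prop} :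
    (∃ b ∈ l.map f, P b) ↔ ∃ a ∈ l, P (f a) := by
  simp

/-- On words with one letter, a formula without conjunctions is a disjunction of leaves. -/
theorem exists_leaves_exists {Op : Set Operator} (hand : Operator.and ∉ Op)
    (huntl : Operator.untl ∉ Op) {φ : LTL A} (hφ : φ.InFragment Op) :
    ∃ L : List (LTL A), (∀ c ∈ L, c.IsLeaf) ∧
      ∀ w : List A, w.length = 1 → (φ.Sat w ↔ ∃ c ∈ L, c.Sat w) := by
  induction φ with
  | top => exact ⟨[top], by simp [IsLeaf], by simp⟩
  | bot => exact ⟨[bot], by simp [IsLeaf], by simp⟩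
  | letter c => exact ⟨[letter c], by simp [IsLeaf], by simp⟩
  | negLetter c => exact ⟨[negLetter c], by simp [IsLeaf], by simp⟩
  | and φ ψ => exact absurd hφ.1 hand
  | untl φ ψ => exact absurd hφ.1 huntl
  | or φ ψ ih1 ih2 =>
    obtain ⟨L, hL, h1⟩ := ih1 hφ.2.1
    obtain ⟨M, hM, h2⟩ := ih2 hφ.2.2
    refine ⟨L ++ M, ?_, fun w hw => ?_⟩
    · simp only [List.mem_append]
      rintro c (h | h)
      exacts [hL c h, hM c h]
    · simp only [Sat, h1 w hw, h2 w hw, List.mem_append, or_and_right, exists_or]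
  | next φ => exact ⟨[], by simp, fun w hw => by simp [Sat, hw]⟩
  | eventually φ ih =>
    obtain ⟨L, hL, h⟩ := ih hφ.2
    exact ⟨L, hL, fun w hw => (sat_eventually_of_length_eq_one hw).trans (h w hw)⟩
  | globally φ ih =>
    obtain ⟨L, hL, h⟩ := ih hφ.2
    exact ⟨L, hL, fun w hw => (sat_globally_of_length_eq_one hw).trans (h w hw)⟩

/-- Without conjunctions, every formula is a disjunction of basic formulas and of formulas
`X ⋯ X G ψ`: the operators `X` and `F` distribute over disjunctions and commute, and `F G ψ`
speaks of the last letter only. -/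
theorem exists_disjunctive_form {Op : Set Operator} (hand : Operator.and ∉ Op)
    (huntl : Operator.untl ∉ Op) {φ : LTL A} (hφ : φ.InFragment Op) :
    ∃ (L : List (LTL A)) (M : List (ℕ × LTL A)),
      (∀ ψ ∈ L, ψ.IsBasic ∧ ψ.InFragment Op) ∧
      (∀ p ∈ M, (nexts p.1 (globally p.2)).InFragment Op ∧ p.2.size < φ.size) ∧
      ∀ w, w ≠ [] →
        (φ.Sat w ↔ (∃ ψ ∈ L, ψ.Sat w) ∨ ∃ p ∈ M, (nexts p.1 (globally p.2)).Sat w) := by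
  induction φ with
  | top => exact ⟨[top], [], by simp [isBasic_top, InFragment], by simp, by simp⟩
  | bot => exact ⟨[bot], [], by simp [isBasic_bot, InFragment], by simp, by simp⟩
  | letter c => exact ⟨[letter c], [], by simp [isBasic_letter, InFragment], by simp, by simp⟩
  | negLetter c =>
    exact ⟨[negLetter c], [], by simp [isBasic_negLetter, InFragment], by simp, by simp⟩
  | and φ ψ => exact absurd hφ.1 hand
  | untl φ ψ => exact absurd hφ.1 huntl
  | or φ ψ ih1 ih2 =>
    obtain ⟨L, M, hL, hM, h1⟩ := ih1 hφ.2.1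
    obtain ⟨L', M', hL', hM', h2⟩ := ih2 hφ.2.2
    refine ⟨L ++ L', M ++ M', ?_, ?_, fun w hw => ?_⟩
    · simp only [List.mem_append]
      rintro c (h | h)
      exacts [hL c h, hL' c h]
    · simp only [List.mem_append, size]
      rintro p (h | h)
      · exact ⟨(hM p h).1, by have := (hM p h).2; omega⟩
      · exact ⟨(hM' p h).1, by have := (hM' p h).2; omega⟩
    · simp only [Sat, h1 w hw, h2 w hw, List.mem_append, or_and_right, exists_or]
      exact or_or_or_comm
  | next φ ih =>
    obtain ⟨L, M, hL, hM, h⟩ := ih hφ.2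
    refine ⟨L.map next, M.map fun p => (p.1 + 1, p.2), ?_, ?_, fun w hw => ?_⟩
    · simp only [List.mem_map]
      rintro _ ⟨ψ, hψ, rfl⟩
      exact ⟨(hL ψ hψ).1.next, hφ.1, (hL ψ hψ).2⟩
    · simp only [List.mem_map]
      rintro _ ⟨p, hp, rfl⟩
      exact ⟨⟨hφ.1, (hM p hp).1⟩, (hM p hp).2.trans (Nat.lt_succ_self _)⟩
    · simp only [exists_mem_map, nexts, Sat]
      by_cases hlen : 1 < w.length
      · have := h (w.drop 1) (List.length_pos_iff.1 (by simpa using hlen))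
        simp only [List.drop_one] at this ⊢
        simp [hlen, this]
      · simp [hlen]
  | globally φ ih =>
    exact ⟨[], [(0, φ)], by simp, by simp [nexts, hφ, size], by simp [nexts]⟩
  | eventually φ ih =>
    obtain ⟨L, M, hL, hM, h⟩ := ih hφ.2
    -- The disjunctive forms of the formulas `F ψ` for `ψ ∈ L` and `F X ⋯ X G ψ` for `ψ ∈ M`.
    have h1 : ∀ ψ ∈ L, ∃ χ : LTL A, χ.IsBasic ∧ χ.InFragment Op ∧
        Equivalent ψ.eventually χ := fun ψ hψ =>
      (hL ψ hψ).1.exists_eventually ⟨hφ.1, (hL ψ hψ).2⟩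
    have h2 : ∀ p ∈ M, ∃ K : List (LTL A), (∀ ψ ∈ K, ψ.IsBasic ∧ ψ.InFragment Op) ∧
        ∀ w, w ≠ [] → ((eventually (nexts p.1 (globally p.2))).Sat w ↔ ∃ ψ ∈ K, ψ.Sat w) := by
      intro p hp
      have hfrag := inFragment_nexts.1 (hM p hp).1
      obtain ⟨C, hC, h2⟩ := exists_leaves_exists hand huntl hfrag.2.2
      refine ⟨C.map fun c => nexts p.1 (eventually (globally c)), ?_, fun w hw => ?_⟩
      · simp only [List.forall_mem_map]
        exact fun c hc => ⟨⟨p.1, c, hC c hc, by simp⟩,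
          inFragment_nexts.2 ⟨hfrag.1, hφ.1, hfrag.2.1, (hC c hc).inFragment⟩⟩
      · rw [sat_eventually_nexts hw]
        simp only [exists_mem_map, sat_nexts hw]
        by_cases hlen : p.1 < w.length
        · have hne : w.drop p.1 ≠ [] := by simpa using hlen
          simp only [hlen, true_and, sat_eventually_globally hne]
          exact h2 _ (length_drop_length_sub_one hne)
        · simp [hlen]
    choose! f hf using h1
    choose! g hg using h2
    refine ⟨L.map f ++ M.flatMap g, [], ?_, by simp, fun w hw => ?_⟩
    · simp only [List.mem_append, List.mem_map, List.mem_flatMap]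
      rintro _ (⟨ψ, hψ, rfl⟩ | ⟨p, hp, hψ⟩)
      · exact ⟨(hf ψ hψ).1, (hf ψ hψ).2.1⟩
      · exact (hg p hp).1 _ hψ
    · have e1 : (eventually φ).Sat w ↔ (∃ ψ ∈ L, (eventually ψ).Sat w) ∨
          ∃ p ∈ M, (eventually (nexts p.1 (globally p.2))).Sat w := by
        constructor
        · rintro ⟨i, hi, hi'⟩
          rcases (h (w.drop i) (by simpa using hi)).1 hi' with ⟨ψ, hψ, h3⟩ | ⟨p, hp, h3⟩
          exacts [Or.inl ⟨ψ, hψ, i, hi, h3⟩, Or.inr ⟨p, hp, i, hi, h3⟩]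
        · rintro (⟨ψ, hψ, i, hi, h3⟩ | ⟨p, hp, i, hi, h3⟩)
          · exact ⟨i, hi, (h (w.drop i) (by simpa using hi)).2 (Or.inl ⟨ψ, hψ, h3⟩)⟩
          · exact ⟨i, hi, (h (w.drop i) (by simpa using hi)).2 (Or.inr ⟨p, hp, h3⟩)⟩
      rw [e1]
      simp only [List.mem_append, List.mem_flatMap, or_and_right, exists_or,
        exists_mem_map, List.not_mem_nil, false_and, exists_false, or_false]
      refine or_congr (exists_congr fun ψ => and_congr_right fun hψ => (hf ψ hψ).2.2 w hw) ?_
      refine Iff.trans (exists_congr fun p => and_congr_right fun hp => (hg p hp).2 w hw) ?_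
      exact ⟨fun ⟨p, hp, ψ, h3, h4⟩ => ⟨ψ, ⟨p, hp, h3⟩, h4⟩,
        fun ⟨ψ, ⟨p, hp, h3⟩, h4⟩ => ⟨p, hp, ψ, h3, h4⟩⟩

/-- Without conjunctions, a formula `G φ` that holds for `v` has a short strengthening that holds
for `v`. At each suffix of `v` one disjunct of `φ` holds. If it is some `X ⋯ X G ψ` with `k`
operators `X`, it also holds at all later suffixes except the last `k` ones, and `ψ` is
strengthened with respect to a shorter word. The last `k` suffixes are treated in the same way;
the lengths of the words that appear have a sum of at most the length of `v`, which keeps the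
size polynomial. -/
theorem exists_stronger_globally {Op : Set Operator} (hor : Operator.or ∈ Op)
    (hand : Operator.and ∉ Op) (huntl : Operator.untl ∉ Op) (n : ℕ) :
    ∀ (φ : LTL A), φ.InFragment Op → ∀ v : List A, v.length = n → v ≠ [] →
      (globally φ).Sat v →
      ∃ ψ : LTL A, ψ.InFragment Op ∧ ψ.size ≤ n * (n + 5) ^ 2 ∧
        (∀ w, w ≠ [] → (globally ψ).Sat w → (globally φ).Sat w) ∧
        (globally ψ).Sat v := by
  induction n using Nat.strong_induction_on with
  | _ n ihn =>
  intro φ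
  induction hs : φ.size using Nat.strong_induction_on generalizing φ with
  | _ s ihs =>
  subst hs
  intro hφ v hlen hv hsat
  have hn : 0 < n := hlen ▸ List.length_pos_iff.2 hv
  obtain ⟨L, M, hL, hM, hform⟩ := exists_disjunctive_form hand huntl hφ
  by_cases hzero : ∃ p ∈ M, p.1 = 0 ∧ (globally p.2).Sat v
  · -- `G p.2` implies `G φ`, and `p.2` is a smaller formula.
    obtain ⟨p, hp, hk, hpv⟩ := hzero
    have hfrag := inFragment_nexts.1 (hM p hp).1
    obtain ⟨ψ, h1, h2, h3, h4⟩ := ihs _ (hM p hp).2 p.2 rfl hfrag.2.2 v hlen hv hpv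
    refine ⟨ψ, h1, h2, fun w hw hsat i hi => ?_, h4⟩
    refine (hform (w.drop i) (by simpa using hi)).2 (Or.inr ⟨p, hp, ?_⟩)
    rw [hk, nexts, sat_globally_drop hi]
    exact fun j _ hj => h3 w hw hsat j hj
  -- At each of the last `j` suffixes of `v`, one formula of a list `K` of strengthenings of `φ`
  -- holds.
  have cover : ∀ j ≤ n, ∃ K : List (LTL A),
      (∀ ψ ∈ K, ψ.InFragment Op ∧ ∀ w, w ≠ [] → ψ.Sat w → φ.Sat w) ∧
      (∀ i, n - j ≤ i → i < n → ∃ ψ ∈ K, ψ.Sat (v.drop i)) ∧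
      (K.map fun ψ => ψ.size + 1).sum ≤ j * ((n + 4) ^ 2 + n + 3) := by
    intro j
    induction j using Nat.strong_induction_on with
    | _ j ihj =>
    intro hj
    rcases Nat.eq_zero_or_pos j with rfl | hj0
    · exact ⟨[], by simp, by intro i; omega, by simp⟩
    have hp : n - j < v.length := by omega
    have hne : v.drop (n - j) ≠ [] := by simpa using hp
    rcases (hform _ hne).1 (hsat _ hp) with ⟨ψ, hψ, hψv⟩ | ⟨⟨k, ψ⟩, hψ, hψv⟩
    · obtain ⟨K, hK1, hK2, hK3⟩ := ihj (j - 1) (by omega) (by omega)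
      refine ⟨ψ :: K, ?_, fun i h5 h6 => ?_, ?_⟩
      · rw [List.forall_mem_cons]
        exact ⟨⟨(hL ψ hψ).2, fun w hw h => (hform w hw).2 (Or.inl ⟨ψ, hψ, h⟩)⟩, hK1⟩
      · rcases Nat.eq_or_lt_of_le h5 with rfl | h5
        · exact ⟨ψ, by simp, hψv⟩
        · obtain ⟨θ, h7, h8⟩ := hK2 i (by omega) h6
          exact ⟨θ, by simp [h7], h8⟩
      · have h9 := (hL ψ hψ).1.size_le_of_sat hne hψv
        rw [List.length_drop] at h9
        obtain ⟨m, rfl⟩ : ∃ m, j = m + 1 := ⟨j - 1, by omega⟩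
        rw [Nat.add_sub_cancel] at hK3
        simp only [List.map_cons, List.sum_cons, Nat.succ_mul]
        have := Nat.zero_le ((n + 4) ^ 2)
        omega
    · simp only at hψv
      have hfrag := inFragment_nexts.1 (hM _ hψ).1
      have himp : ∀ w, w ≠ [] → (nexts k (globally ψ)).Sat w → φ.Sat w :=
        fun w hw h => (hform w hw).2 (Or.inr ⟨_, hψ, h⟩)
      rw [sat_nexts_drop hp] at hψv
      obtain ⟨hlt, hψv⟩ := hψv
      have hpos : 0 < n - j + k := by
        by_contra h0
        refine hzero ⟨_, hψ, by simp only; omega, ?_⟩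
        rwa [show n - j + k = 0 by omega, List.drop_zero] at hψv
      have hlen' : (v.drop (n - j + k)).length = j - k := by rw [List.length_drop, hlen]; omega
      obtain ⟨χ, h1, h2, h3, h4⟩ := ihn (j - k) (by omega) ψ hfrag.2.2 (v.drop (n - j + k)) hlen'
        (List.length_pos_iff.1 (by omega)) hψv
      obtain ⟨K, hK1, hK2, hK3⟩ := ihj k (by omega) (by omega)
      refine ⟨nexts k (globally χ) :: K, ?_, fun i h5 h6 => ?_, ?_⟩
      · rw [List.forall_mem_cons]
        refine ⟨⟨inFragment_nexts.2 ⟨hfrag.1, hfrag.2.1, h1⟩, fun w hw h => himp w hw ?_⟩, hK1⟩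
        rw [sat_nexts hw] at h ⊢
        exact ⟨h.1, h3 _ (by simpa using h.1) h.2⟩
      · rcases lt_or_ge i (n - k) with h7 | h7
        · refine ⟨_, List.mem_cons_self, ?_⟩
          rw [sat_nexts_drop (by omega), sat_globally_drop (by omega)]
          rw [sat_globally_drop hlt] at h4
          exact ⟨by omega, fun r h8 h9 => h4 r (by omega) h9⟩
        · obtain ⟨θ, h7, h8⟩ := hK2 i (by omega) h6
          exact ⟨θ, by simp [h7], h8⟩
      · simp only [List.map_cons, List.sum_cons, size_nexts, size]
        have h5 : (j - k) * (j - k + 5) ^ 2 ≤ (j - k) * (n + 4) ^ 2 :=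
          Nat.mul_le_mul le_rfl (Nat.pow_le_pow_left (by omega) 2)
        obtain ⟨m, rfl⟩ : ∃ m, j = k + m := ⟨j - k, by omega⟩
        rw [Nat.add_sub_cancel_left] at h2 h5
        have h6 : n + 3 ≤ m * (n + 3) := Nat.le_mul_of_pos_left _ (by omega)
        nlinarith
  obtain ⟨K, hK1, hK2, hK3⟩ := cover n le_rfl
  refine ⟨bigOr K, inFragment_bigOr hor fun ψ hψ => (hK1 ψ hψ).1, ?_, ?_, ?_⟩
  · rw [size_bigOr]
    nlinarith
  · intro w hw h i hi
    obtain ⟨ψ, h1, h2⟩ := sat_bigOr.1 (h i hi)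
    exact (hK1 ψ h1).2 _ (by simpa using hi) h2
  · intro i hi
    obtain ⟨ψ, h1, h2⟩ := hK2 i (by omega) (by omega)
    exact sat_bigOr.2 ⟨ψ, h1, h2⟩

/-- Without conjunctions, a formula that holds for `v` has a short strengthening that holds
for `v`. -/
theorem exists_stronger {Op : Set Operator} (hor : Operator.or ∈ Op) (hand : Operator.and ∉ Op)
    (huntl : Operator.untl ∉ Op) {φ : LTL A} (hφ : φ.InFragment Op) {v : List A} (hv : v ≠ [])
    (hsat : φ.Sat v) :
    ∃ ψ : LTL A, ψ.InFragment Op ∧ ψ.size ≤ (v.length + 5) ^ 3 ∧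
      (∀ w, w ≠ [] → ψ.Sat w → φ.Sat w) ∧ ψ.Sat v := by
  have hn : 0 < v.length := List.length_pos_iff.2 hv
  have hpow : v.length + 5 ≤ (v.length + 5) ^ 3 := Nat.le_self_pow (by norm_num) _
  obtain ⟨L, M, hL, hM, hform⟩ := exists_disjunctive_form hand huntl hφ
  rcases (hform v hv).1 hsat with ⟨ψ, hψ, hψv⟩ | ⟨⟨k, ψ⟩, hψ, hψv⟩
  · have := (hL ψ hψ).1.size_le_of_sat hv hψv
    exact ⟨ψ, (hL ψ hψ).2, by omega, fun w hw h => (hform w hw).2 (Or.inl ⟨ψ, hψ, h⟩), hψv⟩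
  · simp only at hψv
    have hfrag := inFragment_nexts.1 (hM _ hψ).1
    rw [sat_nexts hv] at hψv
    have hlen' : (v.drop k).length = v.length - k := by simp
    obtain ⟨χ, h1, h2, h3, h4⟩ := exists_stronger_globally hor hand huntl _ ψ hfrag.2.2
      (v.drop k) hlen' (List.length_pos_iff.1 (by omega)) hψv.2
    refine ⟨nexts k (globally χ), inFragment_nexts.2 ⟨hfrag.1, hfrag.2.1, h1⟩, ?_,
      fun w hw h => (hform w hw).2 (Or.inr ⟨_, hψ, ?_⟩), ?_⟩
    · rw [size_nexts, size]
      have : (v.length - k) * (v.length - k + 5) ^ 2 ≤ v.length * (v.length + 5) ^ 2 :=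
        Nat.mul_le_mul (by omega) (Nat.pow_le_pow_left (by omega) 2)
      nlinarith
    · rw [sat_nexts hw] at h ⊢
      exact ⟨h.1, h3 _ (by simpa using h.1) h.2⟩
    · rw [sat_nexts hv]
      exact ⟨hψv.1, h4⟩


/-! ### Conjunction and disjunction -/

theorem InFragment.mono {Op Op' : Set Operator} {φ : LTL A} (hφ : φ.InFragment Op)
    (h : Op ⊆ Op') : φ.InFragment Op' := by
  induction φ with
  | top | bot | letter c | negLetter c => trivial
  | and φ ψ ih1 ih2 | or φ ψ ih1 ih2 | untl φ ψ ih1 ih2 =>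
    exact ⟨h hφ.1, ih1 hφ.2.1, ih2 hφ.2.2⟩
  | next φ ih | eventually φ ih | globally φ ih => exact ⟨h hφ.1, ih hφ.2⟩

theorem sat_eventually_cons {φ : LTL A} {a : A} {w : List A} :
    (eventually φ).Sat (a :: w) ↔ φ.Sat (a :: w) ∨ (eventually φ).Sat w := by
  constructor
  · rintro ⟨_ | i, hi, h⟩
    exacts [Or.inl h, Or.inr ⟨i, by simpa using hi, h⟩]
  · rintro (h | ⟨i, hi, h⟩)
    exacts [⟨0, by simp, h⟩, ⟨i + 1, by simpa using hi, h⟩]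

theorem sat_globally_cons {φ : LTL A} {a : A} {w : List A} :
    (globally φ).Sat (a :: w) ↔ φ.Sat (a :: w) ∧ (globally φ).Sat w := by
  constructor
  · exact fun h => ⟨h 0 (by simp), fun i hi => h (i + 1) (by simpa using hi)⟩
  · rintro ⟨h0, h⟩ (_ | i) hi
    exacts [h0, h i (by simpa using hi)]

/-- Formulas without `G` and `U` are preserved when the word is continued. -/
theorem Sat.append {Op : Set Operator} (hglobally : Operator.globally ∉ Op)
    (huntl : Operator.untl ∉ Op) {φ : LTL A} (hφ : φ.InFragment Op) {u : List A} (hu : u ≠ [])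
    (t : List A) (h : φ.Sat u) : φ.Sat (u ++ t) := by
  have hhead : ∀ u : List A, u ≠ [] → (u ++ t).head? = u.head? :=
    fun u hu => List.head?_append_of_ne_nil u hu
  induction φ generalizing u with
  | top => trivial
  | bot => exact h
  | letter c => exact (hhead u hu).trans h
  | negLetter c => exact fun h' => h ((hhead u hu).symm.trans h')
  | and φ ψ ih1 ih2 => exact ⟨ih1 hφ.2.1 hu h.1, ih2 hφ.2.2 hu h.2⟩
  | or φ ψ ih1 ih2 => exact h.imp (ih1 hφ.2.1 hu) (ih2 hφ.2.2 hu)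
  | next φ ih =>
    obtain ⟨h1, h2⟩ := h
    refine ⟨by simp; omega, ?_⟩
    rw [List.drop_append_of_le_length h1.le]
    exact ih hφ.2 (List.length_pos_iff.1 (by simpa using h1)) h2
  | eventually φ ih =>
    obtain ⟨i, h1, h2⟩ := h
    refine ⟨i, by simp; omega, ?_⟩
    rw [List.drop_append_of_le_length h1.le]
    exact ih hφ.2 (by simpa using h1) h2
  | globally φ ih => exact absurd hφ.1 hglobally
  | untl φ ψ => exact absurd hφ.1 huntl

/-- Formulas without `U` are preserved when the last letter is repeated. -/
theorem Sat.append_last {Op : Set Operator} (huntl : Operator.untl ∉ Op) {φ : LTL A}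
    (hφ : φ.InFragment Op) {u : List A} {c : A} (h : φ.Sat (u ++ [c])) :
    φ.Sat (u ++ [c] ++ [c]) := by
  have hhead : ∀ u : List A, (u ++ [c] ++ [c]).head? = (u ++ [c]).head? :=
    fun u => List.head?_append_of_ne_nil (u ++ [c]) (by simp)
  induction φ generalizing u with
  | top => trivial
  | bot => exact h
  | letter a => exact (hhead u).trans h
  | negLetter a => exact fun h' => h ((hhead u).symm.trans h')
  | and φ ψ ih1 ih2 => exact ⟨ih1 hφ.2.1 h.1, ih2 hφ.2.2 h.2⟩
  | or φ ψ ih1 ih2 => exact h.imp (ih1 hφ.2.1) (ih2 hφ.2.2)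
  | next φ ih =>
    obtain ⟨h1, h2⟩ := h
    cases u with
    | nil => simp at h1
    | cons a u => exact ⟨by simp, ih hφ.2 h2⟩
  | eventually φ ih =>
    obtain ⟨i, h1, h2⟩ := h
    have hi : i ≤ u.length := by simpa [Nat.lt_succ_iff] using h1
    rw [List.drop_append_of_le_length hi] at h2
    refine ⟨i, by simp; omega, ?_⟩
    rw [List.append_assoc, List.drop_append_of_le_length hi, ← List.append_assoc]
    exact ih hφ.2 h2
  | globally φ ih =>
    intro i hi
    rcases Nat.lt_or_ge u.length i with h1 | h1
    · have h2 : i = (u ++ [c]).length := by simp at hi ⊢; omega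
      have h3 := h u.length (by simp)
      rw [List.drop_left] at h3
      rwa [h2, List.drop_left]
    · have h3 := h i (by simp; omega)
      rw [List.drop_append_of_le_length h1] at h3
      rw [List.append_assoc, List.drop_append_of_le_length h1, ← List.append_assoc]
      exact ih hφ.2 h3
  | untl φ ψ => exact absurd hφ.1 huntl

theorem Sat.append_replicate {Op : Set Operator} (huntl : Operator.untl ∉ Op) {φ : LTL A}
    (hφ : φ.InFragment Op) {u : List A} {c : A} (h : φ.Sat (u ++ [c])) (l : ℕ) :
    φ.Sat (u ++ [c] ++ List.replicate l c) := by
  induction l generalizing u with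
  | zero => simpa using h
  | succ l ih =>
    rw [List.replicate_succ, List.append_cons]
    exact ih (h.append_last huntl hφ)

theorem sat_congr_head {φ : LTL A} (hφ : φ.InFragment {Operator.and, Operator.or})
    {u v : List A} (huv : u.head? = v.head?) : φ.Sat u ↔ φ.Sat v := by
  induction φ with
  | top | bot => exact Iff.rfl
  | letter c | negLetter c => simp [Sat, huv]
  | and φ ψ ih1 ih2 => exact and_congr (ih1 hφ.2.1) (ih2 hφ.2.2)
  | or φ ψ ih1 ih2 => exact or_congr (ih1 hφ.2.1) (ih2 hφ.2.2)
  | next φ | eventually φ | globally φ | untl φ => simpa using hφ.1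

/-- The formula `a₁ ∧ F (a₂ ∧ F (a₃ ∧ ⋯))` for the word `a₁ a₂ a₃ ⋯`. It expresses that the word,
up to repetitions of letters, embeds into the given one, the first letter being mapped to the
first letter. -/
def pattern : List A → LTL A
  | [] => top
  | a :: w => and (letter a) (eventually (pattern w))

theorem size_pattern (w : List A) : (pattern w).size = 3 * w.length + 1 := by
  induction w with
  | nil => rfl
  | cons a w ih => simp [pattern, size, ih]; omega

theorem inFragment_pattern {Op : Set Operator} (hand : Operator.and ∈ Op)
    (hev : Operator.eventually ∈ Op) (w : List A) : (pattern w).InFragment Op := by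
  induction w with
  | nil => trivial
  | cons a w ih => exact ⟨hand, trivial, hev, ih⟩

theorem sat_pattern_self (w : List A) : (pattern w).Sat w := by
  induction w with
  | nil => trivial
  | cons a w ih =>
    refine ⟨rfl, ?_⟩
    cases w with
    | nil => exact ⟨0, by simp, trivial⟩
    | cons b w => exact ⟨1, by simp, ih⟩

theorem sat_pattern_drop {u v : List A} (h : (pattern u).Sat v) {i : ℕ} (hi : i < u.length) :
    ∃ j < v.length, (pattern (u.drop i)).Sat (v.drop j) := by
  induction i generalizing u v with
  | zero =>
    cases u with
    | nil => simp at hi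
    | cons a u =>
      refine ⟨0, ?_, h⟩
      obtain ⟨j, hj, -⟩ := h.2
      omega
  | succ i ih =>
    cases u with
    | nil => simp at hi
    | cons a u =>
      obtain ⟨j, hj, h1⟩ := h.2
      obtain ⟨k, hk, h2⟩ := ih h1 (by simpa using hi)
      rw [List.drop_drop] at h2
      exact ⟨j + k, by rw [List.length_drop] at hk; omega, h2⟩

/-- Among the formulas without `X`, `G` and `U`, the pattern of `u` is the strongest one that holds
for `u`. -/
theorem Sat.of_pattern {φ : LTL A}
    (hφ : φ.InFragment {Operator.and, Operator.or, Operator.eventually}) {u v : List A}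
    (h : φ.Sat u) (hu : u ≠ []) (huv : (pattern u).Sat v) : φ.Sat v := by
  have hhead : ∀ u v : List A, u ≠ [] → (pattern u).Sat v → u.head? = v.head? := by
    rintro (_ | ⟨a, u⟩) v hu huv
    exacts [absurd rfl hu, huv.1.symm]
  induction φ generalizing u v with
  | top => trivial
  | bot => exact h
  | letter c => exact (hhead u v hu huv).symm.trans h
  | negLetter c => exact fun h' => h ((hhead u v hu huv).trans h')
  | and φ ψ ih1 ih2 => exact ⟨ih1 hφ.2.1 h.1 hu huv, ih2 hφ.2.2 h.2 hu huv⟩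
  | or φ ψ ih1 ih2 => exact h.imp (ih1 hφ.2.1 · hu huv) (ih2 hφ.2.2 · hu huv)
  | eventually φ ih =>
    obtain ⟨i, hi, h⟩ := h
    obtain ⟨j, hj, h1⟩ := sat_pattern_drop huv hi
    exact ⟨j, hj, ih hφ.2 h (by simpa using hi) h1⟩
  | next φ | globally φ | untl φ => simpa using hφ.1

/-- The negation of a formula, in negation normal form. Only formulas without `X` and `U` are
meant; these operators, which have no dual operator, are left alone. -/
def dual : LTL A → LTL A
  | top => bot
  | bot => top
  | letter c => negLetter c
  | negLetter c => letter c
  | and φ ψ => or φ.dual ψ.dual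
  | or φ ψ => and φ.dual ψ.dual
  | eventually φ => globally φ.dual
  | globally φ => eventually φ.dual
  | next φ => next φ
  | untl φ ψ => untl φ ψ

theorem size_dual (φ : LTL A) : φ.dual.size = φ.size := by
  induction φ <;> simp_all [dual, size]

theorem sat_dual {Op : Set Operator} (hnext : Operator.next ∉ Op) (huntl : Operator.untl ∉ Op)
    {φ : LTL A} (hφ : φ.InFragment Op) {w : List A} : φ.dual.Sat w ↔ ¬ φ.Sat w := by
  induction φ generalizing w with
  | top | bot | letter c | negLetter c => simp [dual, Sat]
  | and φ ψ ih1 ih2 => simp [dual, Sat, ih1 hφ.2.1, ih2 hφ.2.2, imp_iff_not_or]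
  | or φ ψ ih1 ih2 => simp [dual, Sat, ih1 hφ.2.1, ih2 hφ.2.2]
  | eventually φ ih => simp [dual, Sat, ih hφ.2]
  | globally φ ih => simp [dual, Sat, ih hφ.2]
  | next φ => exact absurd hφ.1 hnext
  | untl φ ψ => exact absurd hφ.1 huntl

theorem inFragment_dual {Op : Set Operator} (hev : Operator.eventually ∉ Op)
    (hnext : Operator.next ∉ Op) (huntl : Operator.untl ∉ Op) {φ : LTL A}
    (hφ : φ.InFragment Op) :
    φ.dual.InFragment {Operator.and, Operator.or, Operator.eventually} := by
  induction φ with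
  | top | bot | letter c | negLetter c => trivial
  | and φ ψ ih1 ih2 | or φ ψ ih1 ih2 => exact ⟨by simp, ih1 hφ.2.1, ih2 hφ.2.2⟩
  | globally φ ih => exact ⟨by simp, ih hφ.2⟩
  | eventually φ => exact absurd hφ.1 hev
  | next φ => exact absurd hφ.1 hnext
  | untl φ ψ => exact absurd hφ.1 huntl

theorem inFragment_dual_pattern {Op : Set Operator} (hor : Operator.or ∈ Op)
    (hgl : Operator.globally ∈ Op) (w : List A) : (pattern w).dual.InFragment Op := by
  induction w with
  | nil => trivial
  | cons a w ih => exact ⟨hor, trivial, hgl, ih⟩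

theorem sat_dual_pattern {u v : List A} : (pattern u).dual.Sat v ↔ ¬ (pattern u).Sat v :=
  sat_dual (Op := {Operator.and, Operator.eventually}) (by simp) (by simp)
    (inFragment_pattern (by simp) (by simp) u)

/-- `u` and `v` satisfy the same formulas without `X` and `U`. -/
def StutterEquiv (u v : List A) : Prop :=
  ∀ φ : LTL A, φ.InFragment
    {Operator.and, Operator.or, Operator.eventually, Operator.globally} → (φ.Sat u ↔ φ.Sat v)

theorem StutterEquiv.cons {u v : List A} (h : StutterEquiv u v) (a : A) :
    StutterEquiv (a :: u) (a :: v) := by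
  intro φ hφ
  induction φ with
  | top | bot | letter c | negLetter c => exact Iff.rfl
  | and φ ψ ih1 ih2 => exact and_congr (ih1 hφ.2.1) (ih2 hφ.2.2)
  | or φ ψ ih1 ih2 => exact or_congr (ih1 hφ.2.1) (ih2 hφ.2.2)
  | eventually φ ih =>
    rw [sat_eventually_cons, sat_eventually_cons]
    exact or_congr (ih hφ.2) (h _ hφ)
  | globally φ ih =>
    rw [sat_globally_cons, sat_globally_cons]
    exact and_congr (ih hφ.2) (h _ hφ)
  | next φ | untl φ => simpa using hφ.1

theorem stutterEquiv_cons_cons (a : A) (w : List A) :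
    StutterEquiv (a :: a :: w) (a :: w) := by
  intro φ hφ
  induction φ with
  | top | bot | letter c | negLetter c => exact Iff.rfl
  | and φ ψ ih1 ih2 => exact and_congr (ih1 hφ.2.1) (ih2 hφ.2.2)
  | or φ ψ ih1 ih2 => exact or_congr (ih1 hφ.2.1) (ih2 hφ.2.2)
  | eventually φ ih =>
    rw [sat_eventually_cons, sat_eventually_cons, ih hφ.2]
    tauto
  | globally φ ih =>
    rw [sat_globally_cons, sat_globally_cons, ih hφ.2]
    tauto
  | next φ | untl φ => simpa using hφ.1

open Classical in
/-- The word in which each block of equal letters is replaced by a single letter. -/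
noncomputable def compress : List A → List A
  | [] => []
  | a :: w => if w.head? = some a then compress w else a :: compress w

theorem stutterEquiv_compress (w : List A) : StutterEquiv w (compress w) := by
  induction w with
  | nil => exact fun _ _ => Iff.rfl
  | cons a w ih =>
    rw [compress]
    split_ifs with h
    · obtain ⟨t, rfl⟩ := List.head?_eq_some_iff.1 h
      exact fun φ hφ => (stutterEquiv_cons_cons a t φ hφ).trans (ih φ hφ)
    · exact ih.cons a

theorem head?_compress (w : List A) : (compress w).head? = w.head? := by
  cases w with
  | nil => rfl
  | cons a w =>
    have := (stutterEquiv_compress (a :: w) (letter a) trivial).1 rfl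
    exact this

theorem sat_pattern_compress {u v : List A} (h : (pattern u).Sat v) :
    (pattern (compress u)).Sat v := by
  induction u generalizing v with
  | nil => exact h
  | cons a u ih =>
    obtain ⟨h1, i, hi, h2⟩ := h
    rw [compress]
    split_ifs with hu
    · obtain ⟨t, rfl⟩ := List.head?_eq_some_iff.1 hu
      refine ih ⟨h1, ?_⟩
      obtain ⟨j, -, hj, h3⟩ := (sat_eventually_drop hi).1 h2.2
      exact ⟨j, hj, h3⟩
    · exact ⟨h1, i, hi, ih h2⟩

theorem compress_sublist {u v : List A} (h : (pattern (compress u)).Sat v) :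
    (compress u).Sublist v := by
  induction u generalizing v with
  | nil => exact List.nil_sublist _
  | cons a u ih =>
    rw [compress] at h ⊢
    split_ifs at h ⊢ with hu
    · exact ih h
    · obtain ⟨h1, i, hi, h2⟩ := h
      obtain ⟨t, rfl⟩ := List.head?_eq_some_iff.1 h1
      refine List.Sublist.cons_cons a ?_
      cases i with
      | succ i => exact (ih h2).trans (List.drop_sublist i t)
      | zero =>
        -- The compressed word has no two equal letters in a row.
        cases hc : compress u with
        | nil => exact List.nil_sublist _
        | cons b s =>
          rw [hc] at h2
          have h3 : b = a := by simpa [Sat] using h2.1.symm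
          rw [← head?_compress, hc, h3] at hu
          exact absurd rfl hu

/-- Two words each of which contains the pattern of the other one are equal up to repetitions
of letters. -/
theorem stutterEquiv_of_sat_pattern {u v : List A} (huv : (pattern u).Sat v)
    (hvu : (pattern v).Sat u) : StutterEquiv u v := by
  have key : ∀ {u v : List A}, (pattern u).Sat v → (compress u).Sublist (compress v) :=
    fun {u v} h => compress_sublist (sat_pattern_compress
      ((stutterEquiv_compress v _ (inFragment_pattern (by simp) (by simp) u)).1 h))
  have heq : compress u = compress v := (key huv).antisymm (key hvu)
  intro φ hφ
  rw [stutterEquiv_compress u φ hφ, heq, ← stutterEquiv_compress v φ hφ]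

/-- With conjunctions and disjunctions, two words that can be separated are separated by
a formula of linear size: `X ⋯ X c` or `X ⋯ X G c` if `X` is available, and otherwise the pattern
of the first word, the negated pattern of the second one, or a letter. -/
theorem exists_separating_pair {Op : Set Operator} (hand : Operator.and ∈ Op)
    (hor : Operator.or ∈ Op) (huntl : Operator.untl ∉ Op) {φ : LTL A} (hφ : φ.InFragment Op)
    {u v : List A} (hu : u ≠ []) (hv : v ≠ []) (hφu : φ.Sat u) (hφv : ¬ φ.Sat v) :
    ∃ ψ : LTL A, ψ.InFragment Op ∧ ψ.Sat u ∧ ¬ ψ.Sat v ∧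
      ψ.size ≤ 3 * (u.length + v.length) + 1 := by
  by_cases hnext : Operator.next ∈ Op
  · by_cases hpre : ∃ i, i < u.length ∧ v[i]? ≠ u[i]?
    · obtain ⟨i, hi, hne⟩ := hpre
      refine ⟨nexts i (letter u[i]), inFragment_nexts.2 ⟨Or.inr hnext, trivial⟩, ?_, ?_, ?_⟩
      · rw [sat_nexts hu, Sat, List.head?_drop]
        exact ⟨hi, List.getElem?_eq_getElem hi⟩
      · rw [sat_nexts hv, Sat, List.head?_drop, ← List.getElem?_eq_getElem hi]
        exact fun h => hne h.2
      · rw [size_nexts, size]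
        omega
    push Not at hpre
    obtain ⟨t, rfl⟩ : u <+: v := by
      rw [List.prefix_iff_getElem?]
      intro i hi
      rw [hpre i hi, List.getElem?_eq_getElem hi]
    by_cases hgl : Operator.globally ∈ Op
    · obtain ⟨w, c, rfl⟩ : ∃ w c, u = w ++ [c] := ⟨_, _, (List.dropLast_append_getLast hu).symm⟩
      refine ⟨nexts w.length (globally (letter c)),
        inFragment_nexts.2 ⟨Or.inr hnext, hgl, trivial⟩, ?_, fun h => hφv ?_, ?_⟩
      · rw [sat_nexts hu, List.drop_left]
        simp [Sat]
      · rw [sat_nexts hv, List.append_assoc, List.drop_left] at h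
        have ht : t = List.replicate t.length c := by
          refine List.eq_replicate_iff.2 ⟨rfl, fun b hb => ?_⟩
          obtain ⟨i, hi, rfl⟩ := List.getElem_of_mem hb
          have := h.2 (i + 1) (by simpa using hi)
          simpa [Sat, hi] using this
        rw [ht]
        exact hφu.append_replicate huntl hφ _
      · simp only [size_nexts, size, List.length_append, List.length_singleton]
        omega
    · exact absurd (hφu.append hgl huntl hφ hu t) hφv
  have hsub : ∀ o ∈ Op, o = Operator.and ∨ o = Operator.or ∨
      (o = Operator.eventually ∧ Operator.eventually ∈ Op) ∨
      (o = Operator.globally ∧ Operator.globally ∈ Op) := by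
    rintro (_ | _ | _ | _ | _ | _) ho <;> simp_all
  by_cases h1 : Operator.eventually ∈ Op ∧ ¬ (pattern u).Sat v
  · exact ⟨pattern u, inFragment_pattern hand h1.1 u, sat_pattern_self u, h1.2,
      by rw [size_pattern]; omega⟩
  by_cases h2 : Operator.globally ∈ Op ∧ ¬ (pattern v).Sat u
  · refine ⟨(pattern v).dual, inFragment_dual_pattern hor h2.1 v, sat_dual_pattern.2 h2.2,
      fun h => sat_dual_pattern.1 h (sat_pattern_self v), ?_⟩
    rw [size_dual, size_pattern]
    omega
  by_cases hev : Operator.eventually ∈ Op <;> by_cases hgl : Operator.globally ∈ Op <;>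
    simp only [hev, hgl, true_and, not_not, and_true, and_false, or_false] at h1 h2 hsub
  · refine absurd ((stutterEquiv_of_sat_pattern h1 h2 φ (hφ.mono fun o ho => ?_)).1 hφu) hφv
    simpa using hsub o ho
  · exact absurd (hφu.of_pattern (hφ.mono fun o ho => by simpa using hsub o ho) hu h1) hφv
  · rw [← sat_dual hnext huntl hφ] at hφv
    exact absurd hφu ((sat_dual hnext huntl hφ).1
      (hφv.of_pattern (inFragment_dual hev hnext huntl hφ) hv h2))
  · have hφ' : φ.InFragment {Operator.and, Operator.or} :=
      hφ.mono fun o ho => by simpa using hsub o ho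
    obtain ⟨a, ha⟩ : ∃ a, u.head? = some a := ⟨_, List.head?_eq_some_head hu⟩
    refine ⟨letter a, trivial, ha, fun h => hφv ?_, by rw [size]; omega⟩
    exact (sat_congr_head hφ' (ha.trans (Eq.symm h))).1 hφu

end LTL

/-! ### The short formula property -/

namespace Sample

variable {A : Type}

theorem length_le_size_of_mem_pos {S : Sample A} {u : List A} (hu : u ∈ S.pos) :
    u.length ≤ S.size :=
  (List.single_le_sum (by simp) _ (List.mem_map_of_mem hu)).trans (Nat.le_add_right _ _)

theorem length_le_size_of_mem_neg {S : Sample A} {v : List A} (hv : v ∈ S.neg) :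
    v.length ≤ S.size :=
  (List.single_le_sum (by simp) _ (List.mem_map_of_mem hv)).trans (Nat.le_add_left _ _)

theorem length_le_sum_length {l : List (List A)} (h : ∀ w ∈ l, w ≠ []) :
    l.length ≤ (l.map List.length).sum := by
  have := List.card_nsmul_le_sum (l.map List.length) 1 (by
    simp only [List.forall_mem_map]
    exact fun w hw => List.length_pos_iff.2 (h w hw))
  simpa using this

theorem length_pos_le_size (S : Sample A) : S.pos.length ≤ S.size :=
  (length_le_sum_length S.pos_ne_nil).trans (Nat.le_add_right _ _)

theorem length_neg_le_size (S : Sample A) : S.neg.length ≤ S.size :=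
  (length_le_sum_length S.neg_ne_nil).trans (Nat.le_add_left _ _)

end Sample

namespace LTL

variable {A : Type}

theorem sum_size_le {α : Type} {l : List α} {f : α → LTL A} {n s : ℕ} (hl : l.length ≤ n)
    (hf : ∀ a ∈ l, (f a).size ≤ s) :
    ((l.map f).map fun φ => φ.size + 1).sum ≤ n * (s + 1) := by
  have := List.sum_le_card_nsmul ((l.map f).map fun φ => φ.size + 1) (s + 1) (by
    simp only [List.forall_mem_map]
    exact fun a ha => Nat.succ_le_succ (hf a ha))
  simp only [List.length_map, smul_eq_mul] at this
  exact this.trans (Nat.mul_le_mul_right _ hl)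

theorem exists_short_separating {Op : Set Operator} (huntl : Operator.untl ∉ Op) {S : Sample A}
    {φ : LTL A} (hφ : φ.InFragment Op) (hS : S.Separates φ) :
    ∃ ψ : LTL A, ψ.InFragment Op ∧ S.Separates ψ ∧ ψ.size ≤ (S.size + 10) ^ 6 := by
  have : Nonempty (LTL A) := ⟨top⟩
  obtain ⟨n, hn⟩ : ∃ n, n = S.size := ⟨_, rfl⟩
  have hpow : ∀ k, k ≠ 0 → n + 10 ≤ (n + 10) ^ k := fun k hk => Nat.le_self_pow hk _
  have hmul : n * ((n + 5) ^ 3 + 1) + 1 ≤ (n + 10) ^ 6 := by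
    calc n * ((n + 5) ^ 3 + 1) + 1 ≤ (n + 10) * (n + 10) ^ 3 := by
          have : (n + 5) ^ 3 ≤ (n + 10) ^ 3 := Nat.pow_le_pow_left (by omega) 3
          nlinarith [hpow 3 (by norm_num)]
      _ = (n + 10) ^ 4 := by ring
      _ ≤ (n + 10) ^ 6 := Nat.pow_le_pow_right (by omega) (by norm_num)
  rw [← hn]
  by_cases hand : Operator.and ∈ Op <;> by_cases hor : Operator.or ∈ Op
  · have hpair : ∀ u ∈ S.pos, ∀ v ∈ S.neg, ∃ ψ : LTL A, ψ.InFragment Op ∧ ψ.Sat u ∧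
        ¬ ψ.Sat v ∧ ψ.size ≤ 6 * n + 1 := by
      intro u hu v hv
      obtain ⟨ψ, h1, h2, h3, h4⟩ := exists_separating_pair hand hor huntl hφ
        (S.pos_ne_nil u hu) (S.neg_ne_nil v hv) (hS.1 u hu) (hS.2 v hv)
      have := Sample.length_le_size_of_mem_pos hu
      have := Sample.length_le_size_of_mem_neg hv
      exact ⟨ψ, h1, h2, h3, by omega⟩
    choose! f hf using hpair
    refine ⟨bigOr (S.pos.map fun u => bigAnd (S.neg.map (f u))), ?_, ⟨?_, ?_⟩, ?_⟩
    · refine inFragment_bigOr hor ?_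
      rw [List.forall_mem_map]
      intro u hu
      refine inFragment_bigAnd hand ?_
      rw [List.forall_mem_map]
      exact fun v hv => (hf u hu v hv).1
    · intro u hu
      rw [sat_bigOr, exists_mem_map]
      refine ⟨u, hu, ?_⟩
      rw [sat_bigAnd, List.forall_mem_map]
      exact fun v hv => (hf u hu v hv).2.1
    · intro v hv h
      rw [sat_bigOr, exists_mem_map] at h
      obtain ⟨u, hu, h⟩ := h
      rw [sat_bigAnd, List.forall_mem_map] at h
      exact (hf u hu v hv).2.2.1 (h v hv)
    · rw [size_bigOr]
      have h1 : ∀ u ∈ S.pos, (bigAnd (S.neg.map (f u))).size ≤ n * (6 * n + 1 + 1) + 1 := by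
        intro u hu
        rw [size_bigAnd]
        have := sum_size_le (f := f u) (hn ▸ S.length_neg_le_size)
          fun v hv => (hf u hu v hv).2.2.2
        omega
      have h2 := sum_size_le (hn ▸ S.length_pos_le_size) h1
      calc _ ≤ n * (n * (6 * n + 1 + 1) + 1 + 1) + 1 := Nat.succ_le_succ h2
        _ ≤ (n + 10) ^ 4 := by
          ring_nf
          linarith [Nat.zero_le n, Nat.zero_le (n ^ 2), Nat.zero_le (n ^ 3), Nat.zero_le (n ^ 4)]
        _ ≤ (n + 10) ^ 6 := Nat.pow_le_pow_right (by omega) (by norm_num)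
  · have hneg : ∀ v ∈ S.neg, ∃ ψ : LTL A, ψ.InFragment Op ∧ ψ.size ≤ (n + 5) ^ 3 ∧
        (∀ w, w ≠ [] → φ.Sat w → ψ.Sat w) ∧ ¬ ψ.Sat v := by
      intro v hv
      obtain ⟨ψ, h1, h2, h3, h4⟩ := exists_weaker hand hor huntl hφ (S.neg_ne_nil v hv) (hS.2 v hv)
      have := Sample.length_le_size_of_mem_neg hv
      exact ⟨ψ, h1, h2.trans (Nat.pow_le_pow_left (by omega) 3), h3, h4⟩
    choose! f hf using hneg
    refine ⟨bigAnd (S.neg.map f), inFragment_bigAnd hand ?_, ⟨fun u hu => ?_, fun v hv h => ?_⟩, ?_⟩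
    · rw [List.forall_mem_map]
      exact fun v hv => (hf v hv).1
    · rw [sat_bigAnd, List.forall_mem_map]
      exact fun v hv => (hf v hv).2.2.1 u (S.pos_ne_nil u hu) (hS.1 u hu)
    · rw [sat_bigAnd, List.forall_mem_map] at h
      exact (hf v hv).2.2.2 (h v hv)
    · rw [size_bigAnd]
      have := sum_size_le (hn ▸ S.length_neg_le_size) fun v hv => (hf v hv).2.1
      omega
  · have hpos : ∀ u ∈ S.pos, ∃ ψ : LTL A, ψ.InFragment Op ∧ ψ.size ≤ (n + 5) ^ 3 ∧
        (∀ w, w ≠ [] → ψ.Sat w → φ.Sat w) ∧ ψ.Sat u := by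
      intro u hu
      obtain ⟨ψ, h1, h2, h3, h4⟩ :=
        exists_stronger hor hand huntl hφ (S.pos_ne_nil u hu) (hS.1 u hu)
      have := Sample.length_le_size_of_mem_pos hu
      exact ⟨ψ, h1, h2.trans (Nat.pow_le_pow_left (by omega) 3), h3, h4⟩
    choose! f hf using hpos
    refine ⟨bigOr (S.pos.map f), inFragment_bigOr hor ?_, ⟨fun u hu => ?_, fun v hv h => ?_⟩, ?_⟩
    · rw [List.forall_mem_map]
      exact fun v hv => (hf v hv).1
    · rw [sat_bigOr, exists_mem_map]
      exact ⟨u, hu, (hf u hu).2.2.2⟩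
    · rw [sat_bigOr, exists_mem_map] at h
      obtain ⟨u, hu, h⟩ := h
      exact hS.2 v hv ((hf u hu).2.2.1 v (S.neg_ne_nil v hv) h)
    · rw [size_bigOr]
      have := sum_size_le (hn ▸ S.length_pos_le_size) fun u hu => (hf u hu).2.1
      omega
  · obtain ⟨ψ, h1, h2, h3⟩ := exists_isBasic_equivalent hand hor huntl hφ
    by_cases hsat : ∃ u ∈ S.pos, ψ.Sat u
    · obtain ⟨u, hu, h⟩ := hsat
      refine ⟨ψ, h2, ⟨fun w hw => ?_, fun w hw => ?_⟩, ?_⟩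
      · exact (h3 w (S.pos_ne_nil w hw)).1 (hS.1 w hw)
      · exact fun h => hS.2 w hw ((h3 w (S.neg_ne_nil w hw)).2 h)
      · have h4 := h1.size_le_of_sat (S.pos_ne_nil u hu) h
        have h5 := Sample.length_le_size_of_mem_pos hu
        have h6 := hpow 6 (by norm_num)
        omega
    · have hempty : S.pos = [] := List.eq_nil_iff_forall_not_mem.2 fun u hu =>
        hsat ⟨u, hu, (h3 u (S.pos_ne_nil u hu)).1 (hS.1 u hu)⟩
      refine ⟨bot, trivial, ⟨by simp [hempty], fun _ _ => id⟩, ?_⟩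
      exact Nat.one_le_pow _ _ (by omega)

end LTL

theorem shortFormulaProperty {Op : Set Operator} (huntl : Operator.untl ∉ Op) :
    ShortFormulaProperty Op := by
  refine ⟨(Polynomial.X + 10) ^ 6, fun A _ S ⟨φ, hφ, hS⟩ => ?_⟩
  obtain ⟨ψ, h1, h2, h3⟩ := LTL.exists_short_separating huntl hφ hS
  exact ⟨ψ, h1, h2, by simpa using h3⟩

/-! ### A Turing machine that sweeps over its input -/

/-- A program for a multi-stack machine that checks a certificate, a word over `D`, for an input,
a word over `X`. The letters of the certificate become cells of type `T`. The machine goes through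
the input from right to left and then from left to right. For each symbol it makes a pass over
the cells, in which it uses an evaluation stack over `E`. -/
structure SweepProgram (X D T E Q : Type) where
  /-- the initial control state -/
  init : Q
  /-- the cell written for a letter of the certificate -/
  cell : D → T
  /-- the update before the pass for a symbol; the Boolean is `true` in the second sweep -/
  start : Bool → Q → X → Q
  /-- the action on a cell; the two topmost symbols of the evaluation stack are replaced by at most
  three symbols -/
  act : Q → T → Option E → Option E → Q × T × Option E × Option E × Option E
  /-- the update for a symbol left on the evaluation stack at the end of a pass -/
  clear : Q → E → Q
  /-- the update between the two sweeps -/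
  turn : Q → Q
  /-- the update for a cell read at the end of the computation -/
  drain : Q → T → Q
  /-- the answer -/
  accept : Q → Bool

namespace SweepProgram

variable {X D T E Q : Type} (P : SweepProgram X D T E Q)

/-- The effect of the actions on a list of cells on the control state, the evaluation stack and
the cells. -/
def scan : Q → List E → List T → Q × List E × List T
  | q, s, [] => (q, s, [])
  | q, s, t :: ts =>
    let r := P.act q t s.head? s.tail.head?
    let z := scan r.1
      (r.2.2.1.toList ++ (r.2.2.2.1.toList ++ (r.2.2.2.2.toList ++ s.tail.tail))) ts
    (z.1, z.2.1, r.2.1 :: z.2.2)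

/-- The effect of a pass on the control state and the cells. -/
def pass (c : Q × List T) : Q × List T :=
  ((P.scan c.1 [] c.2).2.1.foldl P.clear (P.scan c.1 [] c.2).1, (P.scan c.1 [] c.2).2.2)

/-- The pass for an input symbol. -/
def round (m : Bool) (c : Q × List T) (x : X) : Q × List T :=
  P.pass (P.start m c.1 x, c.2)

/-- The control state and the cells after the first sweep. -/
def sweep (x : List X) (y : List D) : Q × List T :=
  x.foldr (fun s c => P.round false c s) (P.pass (P.init, (y.map P.cell).reverse))

/-- The answer of the program for an input and a certificate. -/
def verify (xy : List X × List D) : Bool :=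
  let c := P.sweep xy.1 xy.2
  let c' := xy.1.foldl (P.round true) (P.turn c.1, c.2)
  P.accept (c'.2.foldl P.drain c'.1)

theorem length_scan (q : Q) (s : List E) (ts : List T) :
    (P.scan q s ts).2.2.length = ts.length ∧
      (P.scan q s ts).2.1.length ≤ s.length + 3 * ts.length := by
  induction ts generalizing q s with
  | nil => simp [scan]
  | cons t ts ih =>
    have h : ∀ o : Option E, o.toList.length ≤ 1 := by rintro (_ | _) <;> simp
    obtain ⟨r, hr⟩ : ∃ r, r = P.act q t s.head? s.tail.head? := ⟨_, rfl⟩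
    have := ih r.1 (r.2.2.1.toList ++ (r.2.2.2.1.toList ++ (r.2.2.2.2.toList ++ s.tail.tail)))
    simp only [List.length_append, List.length_tail] at this
    have h1 := h r.2.2.1
    have h2 := h r.2.2.2.1
    have h3 := h r.2.2.2.2
    simp only [scan, List.length_cons, ← hr]
    omega

theorem length_pass (c : Q × List T) : (P.pass c).2.length = c.2.length :=
  (P.length_scan _ _ _).1

theorem length_round (m : Bool) (c : Q × List T) (x : X) :
    (P.round m c x).2.length = c.2.length :=
  P.length_pass _

theorem length_foldl_round (m : Bool) (x : List X) (c : Q × List T) :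
    (x.foldl (P.round m) c).2.length = c.2.length := by
  induction x generalizing c with
  | nil => rfl
  | cons s x ih => exact (ih _).trans (P.length_round _ _ _)

/-- The stacks of the machine: the input stack, which also holds the symbols read back during the
first sweep, the reversed input, the cells to be visited, the visited cells, the evaluation stack
and the output stack. -/
inductive Stack
  | inp | rev | cells | visited | eval | out
  deriving DecidableEq

/-- The labels of the machine; the Boolean is `true` in the second sweep. -/
inductive Label
  | load
  | scan (m : Bool)
  | clear (m : Bool)
  | flip (m : Bool)
  | fetchRight
  | fetchLeft
  | drain
  deriving DecidableEq

/-- The internal state of the machine: the control state and buffers for the symbols that have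
just been read. -/
structure Reg (X D T E Q : Type) where
  ctrl : Q
  sym : Option (X ⊕ D) := none
  cell : Option T := none
  fst : Option E := none
  snd : Option E := none

/-- The stack alphabets of the machine. -/
abbrev Alphabet (X D T E : Type) : Stack → Type
  | .inp => X ⊕ D
  | .rev => X
  | .cells => T
  | .visited => T
  | .eval => E
  | .out => Bool

instance : Fintype Stack where
  elems := {.inp, .rev, .cells, .visited, .eval, .out}
  complete k := by cases k <;> simp

instance : Fintype Label where
  elems := {.load, .scan false, .scan true, .clear false, .clear true, .flip false, .flip true,
    .fetchRight, .fetchLeft, .drain}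
  complete l := by rcases l with _ | (_ | _) | (_ | _) | (_ | _) | _ | _ | _ <;> simp

instance [Finite X] [Finite D] [Finite T] [Finite E] [Finite Q] : Finite (Reg X D T E Q) :=
  Finite.of_injective
    (fun r : Reg X D T E Q => (r.ctrl, r.sym, r.cell, r.fst, r.snd)) (by
      rintro ⟨⟩ ⟨⟩ h
      simpa using h)

/-- The stacks as a dependent function. -/
def stackFun (i : List (X ⊕ D)) (r : List X) (c v : List T) (e : List E) (o : List Bool) :
    ∀ k, List (Alphabet X D T E k)
  | .inp => i
  | .rev => r
  | .cells => c
  | .visited => v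
  | .eval => e
  | .out => o

section

variable (i i' : List (X ⊕ D)) (r r' : List X) (c c' v v' : List T) (e e' : List E)
  (o o' : List Bool)

@[simp] theorem update_stackFun_inp :
    Function.update (stackFun i r c v e o) .inp i' = stackFun i' r c v e o := by
  funext k; cases k <;> rfl

@[simp] theorem update_stackFun_rev :
    Function.update (stackFun i r c v e o) .rev r' = stackFun i r' c v e o := by
  funext k; cases k <;> rfl

@[simp] theorem update_stackFun_cells :
    Function.update (stackFun i r c v e o) .cells c' = stackFun i r c' v e o := by
  funext k; cases k <;> rfl

@[simp] theorem update_stackFun_visited :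
    Function.update (stackFun i r c v e o) .visited v' = stackFun i r c v' e o := by
  funext k; cases k <;> rfl

@[simp] theorem update_stackFun_eval :
    Function.update (stackFun i r c v e o) .eval e' = stackFun i r c v e' o := by
  funext k; cases k <;> rfl

@[simp] theorem update_stackFun_out :
    Function.update (stackFun i r c v e o) .out o' = stackFun i r c v e o' := by
  funext k; cases k <;> rfl

end

/-- The result of the action on the buffered cell. -/
def result [Inhabited T] (r : Reg X D T E Q) :
    Q × T × Option E × Option E × Option E :=
  P.act r.ctrl (r.cell.getD default) r.fst r.snd

variable [Inhabited X] [Inhabited D] [Inhabited T] [Inhabited E]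

/-- The buffered input symbol. -/
def Reg.left (r : Reg X D T E Q) : X := (r.sym.bind Sum.getLeft?).getD default

/-- The buffered letter of the certificate. -/
def Reg.right (r : Reg X D T E Q) : D := (r.sym.bind Sum.getRight?).getD default

open Turing.TM2.Stmt in
/-- The statements of the machine. -/
def stmt : Label → Turing.TM2.Stmt (Alphabet X D T E) Label (Reg X D T E Q)
  | .load =>
    pop .inp (fun r s => { r with sym := s }) <|
    branch (fun r => r.sym.isNone) (goto fun _ => .scan false) <|
    branch (fun r => (r.sym.bind Sum.getLeft?).isSome)
      (push .rev Reg.left <| load (fun r => ⟨r.ctrl, none, none, none, none⟩) <|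
        goto fun _ => .load)
      (push .cells (fun r => P.cell r.right) <|
        load (fun r => ⟨r.ctrl, none, none, none, none⟩) <| goto fun _ => .load)
  | .scan m =>
    let next := load (fun r => ⟨(P.result r).1, none, none, none, none⟩) <| goto fun _ => .scan m
    let next := branch (fun r => (P.result r).2.2.1.isSome)
      (push .eval (fun r => (P.result r).2.2.1.getD default) next) next
    let next := branch (fun r => (P.result r).2.2.2.1.isSome)
      (push .eval (fun r => (P.result r).2.2.2.1.getD default) next) next
    pop .cells (fun r t => { r with cell := t }) <|
    branch (fun r => r.cell.isNone) (goto fun _ => .clear m) <|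
    pop .eval (fun r e => { r with fst := e }) <|
    pop .eval (fun r e => { r with snd := e }) <|
    push .visited (fun r => (P.result r).2.1) <|
    branch (fun r => (P.result r).2.2.2.2.isSome)
      (push .eval (fun r => (P.result r).2.2.2.2.getD default) next) next
  | .clear m =>
    pop .eval (fun r e => { r with fst := e }) <|
    branch (fun r => r.fst.isNone) (goto fun _ => .flip m) <|
    load (fun r => ⟨P.clear r.ctrl (r.fst.getD default), none, none, none, none⟩) <|
    goto fun _ => .clear m
  | .flip m =>
    pop .visited (fun r t => { r with cell := t }) <|
    branch (fun r => r.cell.isNone) (goto fun _ => if m then .fetchLeft else .fetchRight) <|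
    push .cells (fun r => r.cell.getD default) <|
    load (fun r => ⟨r.ctrl, none, none, none, none⟩) <| goto fun _ => .flip m
  | .fetchRight =>
    pop .rev (fun r x => { r with sym := x.map Sum.inl }) <|
    branch (fun r => r.sym.isNone)
      (load (fun r => ⟨P.turn r.ctrl, none, none, none, none⟩) <| goto fun _ => .fetchLeft) <|
    push .inp (fun r => Sum.inl r.left) <|
    load (fun r => ⟨P.start false r.ctrl r.left, none, none, none, none⟩) <|
    goto fun _ => .scan false
  | .fetchLeft =>
    pop .inp (fun r s => { r with sym := s }) <|
    branch (fun r => r.sym.isNone) (goto fun _ => .drain) <|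
    load (fun r => ⟨P.start true r.ctrl r.left, none, none, none, none⟩) <|
    goto fun _ => .scan true
  | .drain =>
    pop .cells (fun r t => { r with cell := t }) <|
    branch (fun r => r.cell.isNone)
      (push .out (fun r => P.accept r.ctrl) <|
        load (fun _ => ⟨P.init, none, none, none, none⟩) halt) <|
    load (fun r => ⟨P.drain r.ctrl (r.cell.getD default), none, none, none, none⟩) <|
    goto fun _ => .drain

/-- A configuration of the machine with empty buffers and an empty output stack. -/
def config (l : Label) (q : Q) (i : List (X ⊕ D)) (r : List X) (c v : List T) (e : List E) :
    Turing.TM2.Cfg (Alphabet X D T E) Label (Reg X D T E Q) :=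
  ⟨some l, ⟨q, none, none, none, none⟩, stackFun i r c v e []⟩

/-- `P.Reaches n a b` means that the machine gets from `a` to `b` in exactly `n` steps. -/
def Reaches (n : ℕ) (a b : Turing.TM2.Cfg (Alphabet X D T E) Label (Reg X D T E Q)) : Prop :=
  (flip bind (Turing.TM2.step P.stmt))^[n] (some a) = some b

variable {P}

theorem Reaches.refl (a : Turing.TM2.Cfg (Alphabet X D T E) Label (Reg X D T E Q)) :
    P.Reaches 0 a a := rfl

theorem Reaches.trans {m n : ℕ} {a b c : Turing.TM2.Cfg (Alphabet X D T E) Label (Reg X D T E Q)}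
    (h : P.Reaches m a b) (h' : P.Reaches n b c) : P.Reaches (m + n) a c := by
  rw [Reaches, add_comm, Function.iterate_add_apply, h, h']

theorem Reaches.head {n : ℕ} {a b c : Turing.TM2.Cfg (Alphabet X D T E) Label (Reg X D T E Q)}
    (h : Turing.TM2.step P.stmt a = some b) (h' : P.Reaches n b c) : P.Reaches (n + 1) a c := by
  rw [add_comm]
  exact Reaches.trans (m := 1) h h'

theorem reaches_load_cells (q : Q) (r : List X) (c : List T) (y : List D) :
    P.Reaches (y.length + 1) (config .load q (y.map Sum.inr) r c [] [])
      (config (.scan false) q [] r ((y.map P.cell).reverse ++ c) [] []) := by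
  induction y generalizing c with
  | nil => exact Reaches.head (by simp [config, stmt, stackFun]) (Reaches.refl _)
  | cons d y ih =>
    refine Reaches.head (b := config .load q (y.map Sum.inr) r (P.cell d :: c) [] []) ?_ ?_
    · simp [config, stmt, stackFun, Reg.right]
    · simpa using ih (P.cell d :: c)

theorem reaches_load (q : Q) (r : List X) (x : List X) (y : List D) :
    P.Reaches (x.length + y.length + 1)
      (config .load q (x.map Sum.inl ++ y.map Sum.inr) r [] [] [])
      (config (.scan false) q [] (x.reverse ++ r) (y.map P.cell).reverse [] []) := by
  induction x generalizing r with
  | nil => simpa using reaches_load_cells (P := P) q r [] y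
  | cons s x ih =>
    rw [show (s :: x).length + y.length + 1 = (x.length + y.length + 1) + 1 by simp; omega]
    refine Reaches.head
      (b := config .load q (x.map Sum.inl ++ y.map Sum.inr) (s :: r) [] [] []) ?_ ?_
    · simp [config, stmt, stackFun, Reg.left]
    · simpa using ih (s :: r)

theorem reaches_scan (m : Bool) (q : Q) (i : List (X ⊕ D)) (r : List X) (c v : List T)
    (e : List E) :
    P.Reaches (c.length + 1) (config (.scan m) q i r c v e)
      (config (.clear m) (P.scan q e c).1 i r [] ((P.scan q e c).2.2.reverse ++ v)
        (P.scan q e c).2.1) := by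
  induction c generalizing q v e with
  | nil => exact Reaches.head (by simp [config, stmt, stackFun, scan]) (Reaches.refl _)
  | cons t c ih =>
    refine Reaches.head (b := config (.scan m) (P.act q t e.head? e.tail.head?).1 i r c
      ((P.act q t e.head? e.tail.head?).2.1 :: v)
      ((P.act q t e.head? e.tail.head?).2.2.1.toList ++
        ((P.act q t e.head? e.tail.head?).2.2.2.1.toList ++
          ((P.act q t e.head? e.tail.head?).2.2.2.2.toList ++ e.tail.tail)))) ?_ ?_
    · rcases h1 : (P.act q t e.head? e.tail.head?).2.2.1 with _ | a <;>
      rcases h2 : (P.act q t e.head? e.tail.head?).2.2.2.1 with _ | b <;>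
      rcases h3 : (P.act q t e.head? e.tail.head?).2.2.2.2 with _ | d <;>
      simp [config, stmt, stackFun, result] <;> simp_all
    · simpa [scan] using ih _ _ _

theorem reaches_clear (m : Bool) (q : Q) (i : List (X ⊕ D)) (r : List X) (v : List T)
    (e : List E) :
    P.Reaches (e.length + 1) (config (.clear m) q i r [] v e)
      (config (.flip m) (e.foldl P.clear q) i r [] v []) := by
  induction e generalizing q with
  | nil => exact Reaches.head (by simp [config, stmt, stackFun]) (Reaches.refl _)
  | cons a e ih =>
    exact Reaches.head (b := config (.clear m) (P.clear q a) i r [] v e)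
      (by simp [config, stmt, stackFun]) (ih _)

theorem reaches_flip (m : Bool) (q : Q) (i : List (X ⊕ D)) (r : List X) (c v : List T) :
    P.Reaches (v.length + 1) (config (.flip m) q i r c v [])
      (config (if m then .fetchLeft else .fetchRight) q i r (v.reverse ++ c) [] []) := by
  induction v generalizing c with
  | nil => exact Reaches.head (by simp [config, stmt, stackFun]) (Reaches.refl _)
  | cons t v ih =>
    refine Reaches.head (b := config (.flip m) q i r (t :: c) v []) ?_ ?_
    · simp [config, stmt, stackFun]
    · simpa using ih (t :: c)

/-- A pass takes linear time. -/
theorem reaches_pass (m : Bool) (q : Q) (i : List (X ⊕ D)) (r : List X) (c : List T) :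
    ∃ n ≤ 5 * c.length + 3, P.Reaches n (config (.scan m) q i r c [] [])
      (config (if m then .fetchLeft else .fetchRight) (P.pass (q, c)).1 i r
        (P.pass (q, c)).2 [] []) := by
  have h := P.length_scan q [] c
  have h1 := (reaches_scan (P := P) m q i r c [] []).trans ((reaches_clear m _ i r _ _).trans
    (reaches_flip m _ i r [] _))
  simp only [List.append_nil, List.reverse_reverse, List.length_reverse] at h1
  refine ⟨_, ?_, h1⟩
  simp only [List.length_nil] at h
  omega

theorem reaches_fetchRight (x : List X) (i : List (X ⊕ D)) (c : Q × List T) :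
    ∃ n ≤ x.length * (5 * c.2.length + 4) + 1,
      P.Reaches n (config .fetchRight c.1 i x c.2 [] [])
        (config .fetchLeft (P.turn (x.foldl (P.round false) c).1) (x.reverse.map Sum.inl ++ i) []
          (x.foldl (P.round false) c).2 [] []) := by
  induction x generalizing i c with
  | nil => exact ⟨1, by simp, Reaches.head (by simp [config, stmt, stackFun]) (Reaches.refl _)⟩
  | cons s x ih =>
    obtain ⟨n, hn, h⟩ := ih (Sum.inl s :: i) (P.round false c s)
    obtain ⟨k, hk, h'⟩ := reaches_pass (P := P) false (P.start false c.1 s) (Sum.inl s :: i) x c.2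
    refine ⟨k + n + 1, ?_, Reaches.head
      (b := config (.scan false) (P.start false c.1 s) (Sum.inl s :: i) x c.2 [] []) ?_ ?_⟩
    · rw [length_round] at hn
      rw [List.length_cons, Nat.succ_mul]
      omega
    · simp [config, stmt, stackFun, Reg.left]
    · simpa using h'.trans h

theorem reaches_fetchLeft (x : List X) (c : Q × List T) :
    ∃ n ≤ x.length * (5 * c.2.length + 4) + 1,
      P.Reaches n (config .fetchLeft c.1 (x.map Sum.inl) [] c.2 [] [])
        (config .drain (x.foldl (P.round true) c).1 [] [] (x.foldl (P.round true) c).2 [] []) := by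
  induction x generalizing c with
  | nil => exact ⟨1, by simp, Reaches.head (by simp [config, stmt, stackFun]) (Reaches.refl _)⟩
  | cons s x ih =>
    obtain ⟨n, hn, h⟩ := ih (P.round true c s)
    obtain ⟨k, hk, h'⟩ := reaches_pass (P := P) true (P.start true c.1 s) (x.map Sum.inl) [] c.2
    refine ⟨k + n + 1, ?_, Reaches.head
      (b := config (.scan true) (P.start true c.1 s) (x.map Sum.inl) [] c.2 [] []) ?_ ?_⟩
    · rw [length_round] at hn
      rw [List.length_cons, Nat.succ_mul]
      omega
    · simp [config, stmt, stackFun, Reg.left]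
    · exact h'.trans h

theorem reaches_drain (q : Q) (c : List T) :
    P.Reaches (c.length + 1) (config .drain q [] [] c [] [])
      ⟨none, ⟨P.init, none, none, none, none⟩,
        stackFun [] [] [] [] [] [P.accept (c.foldl P.drain q)]⟩ := by
  induction c generalizing q with
  | nil => exact Reaches.head (by simp [config, stmt, stackFun]) (Reaches.refl _)
  | cons t c ih =>
    exact Reaches.head (b := config .drain (P.drain q t) [] [] c [] [])
      (by simp [config, stmt, stackFun]) (ih _)

theorem reaches_verify (x : List X) (y : List D) :
    ∃ n ≤ 20 * (x.length + y.length + 1) ^ 2,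
      P.Reaches n (config .load P.init (x.map Sum.inl ++ y.map Sum.inr) [] [] [] [])
        ⟨none, ⟨P.init, none, none, none, none⟩,
          stackFun [] [] [] [] [] [P.verify (x, y)]⟩ := by
  have h1 := reaches_load (P := P) P.init [] x y
  obtain ⟨n2, hn2, h2⟩ := reaches_pass (P := P) false P.init [] x.reverse (y.map P.cell).reverse
  obtain ⟨n3, hn3, h3⟩ := reaches_fetchRight (P := P) x.reverse []
    (P.pass (P.init, (y.map P.cell).reverse))
  obtain ⟨n4, hn4, h4⟩ := reaches_fetchLeft (P := P) x (P.turn (P.sweep x y).1, (P.sweep x y).2)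
  have h5 := reaches_drain (P := P)
    (x.foldl (P.round true) (P.turn (P.sweep x y).1, (P.sweep x y).2)).1
    (x.foldl (P.round true) (P.turn (P.sweep x y).1, (P.sweep x y).2)).2
  have hlen : (P.sweep x y).2.length = y.length := by
    rw [sweep, ← List.foldl_reverse, length_foldl_round, length_pass]
    simp
  rw [length_foldl_round] at h5
  simp only [hlen, length_pass, List.length_reverse, List.length_map] at hn2 hn3 hn4 h5
  simp only [List.foldl_reverse, List.reverse_reverse, List.append_nil] at h1 h3
  refine ⟨_, ?_, h1.trans (h2.trans (h3.trans (h4.trans h5)))⟩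
  nlinarith

variable (P)

/-- The bundled machine. -/
noncomputable def machine [Finite X] [Finite D] [Finite T] [Finite E] [Finite Q] :
    Turing.FinTM2 where
  K := Stack
  k₀ := .inp
  k₁ := .out
  Γ := Alphabet X D T E
  Λ := Label
  main := .load
  σ := Reg X D T E Q
  initialState := ⟨P.init, none, none, none, none⟩
  σFin := Fintype.ofFinite _
  Γk₀Fin := Fintype.ofFinite (X ⊕ D)
  m := P.stmt

/-- The answer of the program is computed in quadratic time. -/
noncomputable def computableInPolyTime [Finite X] [Finite D] [Finite T] [Finite E] [Finite Q] :
    Turing.TM2ComputableInPolyTime encodePair Computability.encodeBool P.verify where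
  tm := P.machine
  inputAlphabet := Equiv.refl _
  outputAlphabet := Equiv.refl _
  time := 20 * (Polynomial.X + 1) ^ 2
  outputsFun xy := by
    have h := reaches_verify (P := P) xy.1 xy.2
    refine ⟨⟨h.choose, ?_⟩, h.choose_spec.1.trans (by simp [encodePair])⟩
    have h1 : Turing.initList P.machine (List.map (Equiv.refl (X ⊕ D)).invFun (encodePair xy)) =
        config .load P.init (xy.1.map Sum.inl ++ xy.2.map Sum.inr) [] [] [] [] := by
      refine congrArg (Turing.TM2.Cfg.mk _ _) (funext fun k => ?_)
      cases k
      case inp => exact List.map_id (encodePair xy)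
      all_goals rfl
    have h2 : Turing.haltList P.machine
        (List.map (Equiv.refl Bool).invFun (Computability.encodeBool (P.verify xy))) =
        ⟨none, ⟨P.init, none, none, none, none⟩, stackFun [] [] [] [] [] [P.verify xy]⟩ := by
      refine congrArg (Turing.TM2.Cfg.mk _ _) (funext fun k => ?_)
      cases k <;> rfl
    have h3 : (flip bind (Turing.TM2.step P.stmt))^[h.choose] _ = _ := h.choose_spec.2
    exact (congrArg (fun c => (flip bind (Turing.TM2.step P.stmt))^[h.choose] (some c)) h1).trans
      (h3.trans (congrArg some h2.symm))

end SweepProgram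

theorem InNP.of_sweepProgram {X D T E Q : Type} [Finite X] [Finite D] [Finite T] [Finite E]
    [Finite Q] [Inhabited X] [Inhabited D] [Inhabited T] [Inhabited E]
    (P : SweepProgram X D T E Q) (p : Polynomial ℕ) {L : Language X}
    (h : ∀ x, x ∈ L ↔ ∃ y : List D, y.length ≤ p.eval x.length ∧ P.verify (x, y) = true) :
    InNP L := by
  refine ⟨D, inferInstance, P.verify, p, P.computableInPolyTime, ?_, h⟩
  change ∀ s, Finite (SweepProgram.Alphabet X D T E s)
  rintro (_ | _ | _ | _ | _ | _) <;> infer_instance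

/-! ### The verifier -/

/-- The nodes of syntactic trees of formulas without `U`. -/
inductive Token (A : Type)
  | top
  | bot
  | letter (c : A)
  | negLetter (c : A)
  | and
  | or
  | next
  | eventually
  | globally

namespace Verifier

variable {A : Type}

/-- A cell holds a node of a formula, the truth value of the subformula at this node for the part
of the current word that has been read, if any, and a Boolean, used for counting cells. -/
abbrev Cell (A : Type) := Token A × Option Bool × Bool

/-- The evaluation stack holds the truth values of subformulas at the current position and, if
there is one, at the next position of the word. -/
abbrev Value := Bool × Option Bool

/-- The nodes of a formula in postfix order, where the right subtree of a node comes before the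
left one. -/
def nodes : LTL A → List (Token A)
  | .top => [.top]
  | .bot => [.bot]
  | .letter c => [.letter c]
  | .negLetter c => [.negLetter c]
  | .and φ ψ => nodes ψ ++ (nodes φ ++ [.and])
  | .or φ ψ => nodes ψ ++ (nodes φ ++ [.or])
  | .next φ => nodes φ ++ [.next]
  | .eventually φ => nodes φ ++ [.eventually]
  | .globally φ => nodes φ ++ [.globally]
  | .untl _ _ => []

/-- The cells of a formula whose subformulas have the truth values given by `f`. -/
def cellsOf (f : LTL A → Option Bool) : LTL A → List (Cell A)
  | .top => [(.top, f .top, true)]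
  | .bot => [(.bot, f .bot, true)]
  | .letter c => [(.letter c, f (.letter c), true)]
  | .negLetter c => [(.negLetter c, f (.negLetter c), true)]
  | .and φ ψ => cellsOf f ψ ++ (cellsOf f φ ++ [(.and, f (.and φ ψ), true)])
  | .or φ ψ => cellsOf f ψ ++ (cellsOf f φ ++ [(.or, f (.or φ ψ), true)])
  | .next φ => cellsOf f φ ++ [(.next, f (.next φ), true)]
  | .eventually φ => cellsOf f φ ++ [(.eventually, f (.eventually φ), true)]
  | .globally φ => cellsOf f φ ++ [(.globally, f (.globally φ), true)]
  | .untl _ _ => []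

/-- The part of the input that the sweep from right to left is in. -/
inductive Phase
  | neg | pos | bits
  deriving DecidableEq

/-- What is done with the cells in a pass: the evaluation of the formula at a position with the
given letter, where the Boolean says whether the position is the last one of its word; the
replacement of the number `n` of marked cells by `⌈(n - b) / 2⌉`; or nothing. -/
inductive Task (A : Type)
  | eval (a : Option A) (last : Bool)
  | halve (b : Bool)
  | idle

/-- The control states of the verifier: no error has been found yet; the current task; the truth
value of the formula at the last position that was read; whether a word has been read whose mark
is still missing; and the part of the input that has been reached. -/
structure State (A : Type) where
  ok : Bool
  task : Task A
  val : Option Bool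
  pending : Bool
  phase : Phase

section Program

variable (Op : Set Operator)

open Classical in
/-- Whether a node is allowed in `LTL(Op)`. -/
noncomputable def allowed : Token A → Bool
  | .and => decide (Operator.and ∈ Op)
  | .or => decide (Operator.or ∈ Op)
  | .next => decide (Operator.next ∈ Op)
  | .eventually => decide (Operator.eventually ∈ Op)
  | .globally => decide (Operator.globally ∈ Op)
  | _ => true

/-- The number of subtrees of a node. -/
def arity : Token A → ℕ
  | .and | .or => 2
  | .next | .eventually | .globally => 1
  | _ => 0

open Classical in
/-- The truth value of a subformula at a position with letter `a`, given its truth value at the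
next position and the values of its immediate subformulas. It is `none` if one of the latter is
missing. -/
noncomputable def truth (a : Option A) (later : Option Bool) :
    Token A → Option Value → Option Value → Option Bool
  | .top, _, _ => some true
  | .bot, _, _ => some false
  | .letter c, _, _ => some (decide (a = some c))
  | .negLetter c, _, _ => some (decide (a ≠ some c))
  | .and, some x, some y => some (x.1 && y.1)
  | .or, some x, some y => some (x.1 || y.1)
  | .next, some x, _ => some (x.2.getD false)
  | .eventually, some x, _ => some (x.1 || later.getD false)
  | .globally, some x, _ => some (x.1 && later.getD true)
  | _, _, _ => none

/-- The action of the verifier on a cell. -/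
noncomputable def act (q : State A) (t : Cell A) (x y : Option Value) :
    State A × Cell A × Option Value × Option Value × Option Value :=
  match q.task with
  | .idle => (q, t, x, y, none)
  | .halve b =>
    if t.2.2 then ({ q with task := .halve !b }, (t.1, t.2.1, !b), x, y, none)
    else (q, t, x, y, none)
  | .eval a last =>
    let later := if last then none else t.2.1
    match truth a later t.1 x y with
    | none => ({ q with ok := false }, t, none, none, none)
    | some v => ({ q with ok := q.ok && allowed Op t.1 }, (t.1, some v, t.2.2), some (v, later),
        if arity t.1 = 0 then x else if arity t.1 = 1 then y else none,
        if arity t.1 = 0 then y else none)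

/-- The update of the control state before the pass for an input symbol. In the first sweep, the
truth value of the formula at the first position of a word is compared with the mark in front of
the word. -/
def start : Bool → State A → InputSymbol A → State A
  | false, q, .letter c => ⟨q.ok && q.val.isSome && decide (q.phase ≠ .bits),
      .eval (some c) !q.pending, none, true, q.phase⟩
  | false, q, .negMark => ⟨q.ok && q.pending && decide (q.val = some false) &&
      decide (q.phase = .neg), .idle, q.val, false, .neg⟩
  | false, q, .posMark => ⟨q.ok && q.pending && decide (q.val = some true) &&
      decide (q.phase ≠ .bits), .idle, q.val, false, .pos⟩
  | false, q, .bit b => ⟨q.ok && q.val.isSome && !q.pending && (b || decide (q.phase = .bits)),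
      .idle, q.val, false, .bits⟩
  | true, q, .bit b => { q with task := .halve b }
  | true, q, _ => { q with task := .idle }

/-- At the end of an evaluation, the evaluation stack has to hold exactly one value. -/
def clear (q : State A) (x : Value) : State A :=
  if q.val = none then { q with val := some x.1 } else { q with ok := false }

/-- The verifier for the `LTL(Op)` learning problem. The certificate is a formula, written in
prefix order. The formula is evaluated for each word of the sample, from the last position to the
first. Then the number of its nodes is compared with the number `k`, whose bits are read from the
least significant one on. The verifier starts with an evaluation that only serves to check whether
the certificate is a formula of `LTL(Op)`. -/
noncomputable def program : SweepProgram (InputSymbol A) (Token A) (Cell A) Value (State A) where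
  init := ⟨true, .eval none true, none, false, .neg⟩
  cell t := (t, none, true)
  start := start
  act := act Op
  clear := clear
  turn q := { q with ok := q.ok && q.val.isSome && !q.pending }
  drain q t := { q with ok := q.ok && !t.2.2 }
  accept q := q.ok

@[simp] theorem program_start : (program (A := A) Op).start = start := rfl

@[simp] theorem program_act : (program (A := A) Op).act = act Op := rfl

@[simp] theorem program_clear : (program (A := A) Op).clear = clear := rfl

end Program

/-! ### Evaluation of a formula -/

variable {Op : Set Operator}

open Classical in
/-- The truth value of a formula at a position with letter `a`, where `f` gives the truth values
at the next position. -/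
noncomputable def step (a : Option A) (f : LTL A → Option Bool) : LTL A → Bool
  | .top => true
  | .bot => false
  | .letter c => decide (a = some c)
  | .negLetter c => decide (a ≠ some c)
  | .and φ ψ => step a f φ && step a f ψ
  | .or φ ψ => step a f φ || step a f ψ
  | .next φ => (f φ).getD false
  | .eventually φ => step a f φ || (f (.eventually φ)).getD false
  | .globally φ => step a f φ && (f (.globally φ)).getD true
  | .untl _ _ => false

open Classical in
/-- The truth values of formulas for the word `w`, which are undefined if `w` is empty. -/
noncomputable def truthAt (w : List A) (φ : LTL A) : Option Bool :=
  if w = [] then none else some (decide (φ.Sat w))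

theorem truthAt_nil : truthAt (A := A) [] = fun _ => none := by
  funext φ; simp [truthAt]

open Classical in
theorem truthAt_of_ne_nil {w : List A} (hw : w ≠ []) (φ : LTL A) :
    truthAt w φ = some (decide (φ.Sat w)) := by
  simp [truthAt, hw]

theorem step_truthAt_eq_true (huntl : Operator.untl ∉ Op) {φ : LTL A} (hφ : φ.InFragment Op)
    (a : A) (w : List A) : step (some a) (truthAt w) φ = true ↔ φ.Sat (a :: w) := by
  induction φ with
  | top | bot | letter c | negLetter c => simp [step, LTL.Sat]
  | and φ ψ ih1 ih2 => simp [step, LTL.Sat, ih1 hφ.2.1, ih2 hφ.2.2]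
  | or φ ψ ih1 ih2 => simp [step, LTL.Sat, ih1 hφ.2.1, ih2 hφ.2.2]
  | next φ =>
    by_cases hw : w = []
    · simp [step, LTL.Sat, truthAt, hw]
    · simp [step, LTL.Sat, truthAt, hw, List.length_pos_iff]
  | eventually φ ih =>
    by_cases hw : w = []
    · subst hw
      simp [step, truthAt, ih hφ.2, LTL.Sat]
    · simp [step, truthAt, hw, ih hφ.2, LTL.sat_eventually_cons]
  | globally φ ih =>
    by_cases hw : w = []
    · subst hw
      simp [step, truthAt, ih hφ.2, LTL.Sat]
    · simp [step, truthAt, hw, ih hφ.2, LTL.sat_globally_cons]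
  | untl φ ψ => exact absurd hφ.1 huntl

theorem step_truthAt (huntl : Operator.untl ∉ Op) {φ : LTL A} (hφ : φ.InFragment Op) (a : A)
    (w : List A) : some (step (some a) (truthAt w) φ) = truthAt (a :: w) φ := by
  classical
  rw [truthAt_of_ne_nil (by simp), Option.some_inj, Bool.eq_iff_iff, decide_eq_true_iff]
  exact step_truthAt_eq_true huntl hφ a w

theorem map_fst_cellsOf (f : LTL A → Option Bool) (φ : LTL A) :
    (cellsOf f φ).map Prod.fst = nodes φ := by
  induction φ <;> simp_all [cellsOf, nodes]

theorem map_cell_nodes (φ : LTL A) :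
    (nodes φ).map (fun t => (t, none, true)) = cellsOf (fun _ => none) φ := by
  induction φ <;> simp_all [cellsOf, nodes]

theorem length_nodes (huntl : Operator.untl ∉ Op) {φ : LTL A} (hφ : φ.InFragment Op) :
    (nodes φ).length = φ.size := by
  induction φ with
  | top | bot | letter c | negLetter c => rfl
  | and φ ψ ih1 ih2 | or φ ψ ih1 ih2 =>
    simp [nodes, LTL.size, ih1 hφ.2.1, ih2 hφ.2.2]; omega
  | next φ ih | eventually φ ih | globally φ ih => simp [nodes, LTL.size, ih hφ.2]
  | untl φ ψ => exact absurd hφ.1 huntl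

theorem countP_cellsOf (huntl : Operator.untl ∉ Op) {φ : LTL A} (hφ : φ.InFragment Op)
    (f : LTL A → Option Bool) : (cellsOf f φ).countP (fun t => t.2.2) = φ.size := by
  rw [← length_nodes huntl hφ, ← map_fst_cellsOf f φ, List.length_map, List.countP_eq_length]
  clear hφ
  induction φ <;> simp_all [cellsOf, or_imp, forall_and]

/-- The truth values at the next position that an evaluation uses. -/
def prev (last : Bool) (f : LTL A → Option Bool) : LTL A → Option Bool :=
  if last then fun _ => none else f

theorem scan_cellsOf (huntl : Operator.untl ∉ Op) {φ : LTL A} (hφ : φ.InFragment Op)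
    {q : State A} {a : Option A} {last : Bool} (hq : q.task = .eval a last)
    (f : LTL A → Option Bool) (s : List Value) (r : List (Cell A)) :
    (program Op).scan q s (cellsOf f φ ++ r) =
      let z := (program Op).scan q ((step a (prev last f) φ, prev last f φ) :: s) r
      (z.1, z.2.1, cellsOf (fun ψ => some (step a (prev last f) ψ)) φ ++ z.2.2) := by
  obtain ⟨ok, task, val, pending, phase⟩ := q
  simp only at hq
  subst hq
  have hprev : ∀ φ, (if last = true then none else f φ) = prev last f φ := by
    intro φ; cases last <;> rfl
  induction φ generalizing s r with
  | top | bot | letter c | negLetter c =>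
    rcases s with _ | ⟨x, _ | ⟨y, s⟩⟩ <;>
      simp [cellsOf, SweepProgram.scan, act, truth, allowed, arity, hprev, step]
  | and φ ψ ih1 ih2 | or φ ψ ih1 ih2 =>
    simp [cellsOf, ih1 hφ.2.1, ih2 hφ.2.2, List.append_assoc]
    simp [SweepProgram.scan, act, truth, allowed, arity, hprev, step, hφ.1]
  | next φ ih | eventually φ ih | globally φ ih =>
    simp [cellsOf, ih hφ.2, List.append_assoc]
    simp [SweepProgram.scan, act, truth, allowed, arity, hprev, step, hφ.1]
    cases s <;> simp
  | untl φ ψ => exact absurd hφ.1 huntl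

theorem pass_cellsOf (huntl : Operator.untl ∉ Op) {φ : LTL A} (hφ : φ.InFragment Op)
    (ok : Bool) (a : Option A) (last pending : Bool) (phase : Phase) (f : LTL A → Option Bool) :
    (program Op).pass (⟨ok, .eval a last, none, pending, phase⟩, cellsOf f φ) =
      (⟨ok, .eval a last, some (step a (prev last f) φ), pending, phase⟩,
        cellsOf (fun ψ => some (step a (prev last f) ψ)) φ) := by
  have := scan_cellsOf huntl hφ (q := ⟨ok, .eval a last, none, pending, phase⟩) rfl f [] []
  rw [List.append_nil] at this
  simp [SweepProgram.pass, this]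
  simp [SweepProgram.scan, clear]


/-! ### Well-formed certificates -/

theorem ok_of_act {q : State A} {t : Cell A} {x y : Option Value}
    (h : (act Op q t x y).1.ok = true) : q.ok = true := by
  revert h
  unfold act
  split
  · exact id
  · split_ifs <;> exact id
  · dsimp only
    split
    · simp
    · simp +contextual

theorem ok_of_scan {q : State A} {s : List Value} {ts : List (Cell A)}
    (h : ((program Op).scan q s ts).1.ok = true) : q.ok = true := by
  induction ts generalizing q s with
  | nil => exact h
  | cons t ts ih => exact ok_of_act (ih h)

theorem ok_of_clear {q : State A} {x : Value} (h : (clear q x).ok = true) :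
    q.ok = true ∧ q.val = none := by
  unfold clear at h
  split_ifs at h with hq
  exact ⟨h, hq⟩

theorem ok_of_foldl_clear {q : State A} {s : List Value} (h : (s.foldl clear q).ok = true) :
    q.ok = true := by
  induction s generalizing q with
  | nil => exact h
  | cons x s ih => exact (ok_of_clear (ih h)).1

/-- The evaluation stack of a successful evaluation holds exactly one value. -/
theorem length_eq_one_of_foldl_clear {q : State A} {s : List Value} (hq : q.val = none)
    (h : (s.foldl clear q).ok = true) (hval : (s.foldl clear q).val.isSome = true) :
    s.length = 1 := by
  rcases s with _ | ⟨x, _ | ⟨y, s⟩⟩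
  · simp [hq] at hval
  · rfl
  · have := ok_of_clear (ok_of_foldl_clear (q := clear (clear q x) y) h)
    simp [clear, hq] at this

theorem ok_of_pass {c : State A × List (Cell A)} (h : ((program Op).pass c).1.ok = true) :
    c.1.ok = true :=
  ok_of_scan (ok_of_foldl_clear h)

theorem ok_of_round {c : State A × List (Cell A)} {x : InputSymbol A}
    (h : ((program Op).round false c x).1.ok = true) : c.1.ok = true ∧ c.1.val.isSome = true := by
  have := ok_of_pass h
  cases x <;> simp [start] at this <;> simp [this]

/-- The words of nodes read in a successful evaluation are concatenations of formulas. -/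
theorem exists_nodes_of_scan {q : State A} {a : Option A} {last : Bool}
    (hq : q.task = .eval a last) {s : List Value} {ts : List (Cell A)}
    (h : ((program Op).scan q s ts).1.ok = true) {Φ : List (LTL A)}
    (hΦ : ∀ φ ∈ Φ, φ.InFragment Op) (hs : s.length = Φ.length) :
    ∃ Ψ : List (LTL A), (∀ φ ∈ Ψ, φ.InFragment Op) ∧
      ((program Op).scan q s ts).2.1.length = Ψ.length ∧
      Φ.reverse.flatMap nodes ++ ts.map Prod.fst = Ψ.reverse.flatMap nodes := by
  induction ts generalizing q s Φ with
  | nil => exact ⟨Φ, hΦ, hs, by simp⟩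
  | cons t ts ih =>
    obtain ⟨tok, ann, alive⟩ := t
    -- One more node: it takes the topmost formulas as its subformulas.
    suffices ∃ Ψ : List (LTL A), (∀ φ ∈ Ψ, φ.InFragment Op) ∧
        ((act Op q (tok, ann, alive) s.head? s.tail.head?).1.task = .eval a last) ∧
        ((act Op q (tok, ann, alive) s.head? s.tail.head?).2.2.1.toList ++
          ((act Op q (tok, ann, alive) s.head? s.tail.head?).2.2.2.1.toList ++
            ((act Op q (tok, ann, alive) s.head? s.tail.head?).2.2.2.2.toList ++
              s.tail.tail))).length = Ψ.length ∧
        Φ.reverse.flatMap nodes ++ [tok] = Ψ.reverse.flatMap nodes by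
      obtain ⟨Ψ, h1, h2, h3, h4⟩ := this
      obtain ⟨Θ, h5, h6, h7⟩ := ih h2 h h1 h3
      refine ⟨Θ, h5, h6, ?_⟩
      rw [← h7, ← h4]
      simp
    have hok := ok_of_scan (q := (act Op q (tok, ann, alive) s.head? s.tail.head?).1) h
    clear ih h
    obtain ⟨ok, task, val, pending, phase⟩ := q
    simp only at hq
    subst hq
    cases tok with
    | top =>
      refine ⟨.top :: Φ, List.forall_mem_cons.2 ⟨trivial, hΦ⟩, ?_⟩
      rcases s with _ | ⟨x, _ | ⟨y, s⟩⟩ <;> simp_all [act, truth, arity, nodes]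
    | bot =>
      refine ⟨.bot :: Φ, List.forall_mem_cons.2 ⟨trivial, hΦ⟩, ?_⟩
      rcases s with _ | ⟨x, _ | ⟨y, s⟩⟩ <;> simp_all [act, truth, arity, nodes]
    | letter c =>
      refine ⟨.letter c :: Φ, List.forall_mem_cons.2 ⟨trivial, hΦ⟩, ?_⟩
      rcases s with _ | ⟨x, _ | ⟨y, s⟩⟩ <;> simp_all [act, truth, arity, nodes]
    | negLetter c =>
      refine ⟨.negLetter c :: Φ, List.forall_mem_cons.2 ⟨trivial, hΦ⟩, ?_⟩
      rcases s with _ | ⟨x, _ | ⟨y, s⟩⟩ <;> simp_all [act, truth, arity, nodes]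
    | and =>
      rcases s with _ | ⟨x, _ | ⟨y, s⟩⟩ <;> simp [act, truth] at hok
      rcases Φ with _ | ⟨φ, _ | ⟨ψ, Φ⟩⟩ <;> simp at hs
      refine ⟨.and φ ψ :: Φ, ?_⟩
      simp_all [act, truth, arity, nodes, allowed, LTL.InFragment]
    | or =>
      rcases s with _ | ⟨x, _ | ⟨y, s⟩⟩ <;> simp [act, truth] at hok
      rcases Φ with _ | ⟨φ, _ | ⟨ψ, Φ⟩⟩ <;> simp at hs
      refine ⟨.or φ ψ :: Φ, ?_⟩
      simp_all [act, truth, arity, nodes, allowed, LTL.InFragment]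
    | next =>
      rcases s with _ | ⟨x, s⟩ <;> simp [act, truth] at hok
      rcases Φ with _ | ⟨φ, Φ⟩ <;> simp at hs
      refine ⟨.next φ :: Φ, ?_⟩
      rcases s with _ | ⟨y, s⟩
      · obtain rfl := List.length_eq_zero_iff.1 hs.symm
        simp_all [act, truth, arity, nodes, allowed, LTL.InFragment]
      · simp_all [act, truth, arity, nodes, allowed, LTL.InFragment]
    | eventually =>
      rcases s with _ | ⟨x, s⟩ <;> simp [act, truth] at hok
      rcases Φ with _ | ⟨φ, Φ⟩ <;> simp at hs
      refine ⟨.eventually φ :: Φ, ?_⟩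
      rcases s with _ | ⟨y, s⟩
      · obtain rfl := List.length_eq_zero_iff.1 hs.symm
        simp_all [act, truth, arity, nodes, allowed, LTL.InFragment]
      · simp_all [act, truth, arity, nodes, allowed, LTL.InFragment]
    | globally =>
      rcases s with _ | ⟨x, s⟩ <;> simp [act, truth] at hok
      rcases Φ with _ | ⟨φ, Φ⟩ <;> simp at hs
      refine ⟨.globally φ :: Φ, ?_⟩
      rcases s with _ | ⟨y, s⟩
      · obtain rfl := List.length_eq_zero_iff.1 hs.symm
        simp_all [act, truth, arity, nodes, allowed, LTL.InFragment]
      · simp_all [act, truth, arity, nodes, allowed, LTL.InFragment]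

/-- The control state and the cells after the initial evaluation. -/
noncomputable def initial (Op : Set Operator) (y : List (Token A)) : State A × List (Cell A) :=
  (program Op).pass ((program Op).init, (y.map (program Op).cell).reverse)

theorem exists_nodes_of_initial {y : List (Token A)} (h : (initial Op y).1.ok = true)
    (hval : (initial Op y).1.val.isSome = true) :
    ∃ φ : LTL A, φ.InFragment Op ∧ y = (nodes φ).reverse := by
  have hok := ok_of_foldl_clear h
  obtain ⟨Ψ, h1, h2, h3⟩ := exists_nodes_of_scan (a := none) (last := true) rfl hok
    (Φ := []) (by simp) rfl
  -- The control state after reading the cells still has no truth value.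
  have hq : ∀ (ts : List (Cell A)) (q : State A) (s : List Value), q.val = none →
      ((program Op).scan q s ts).1.val = none := by
    intro ts
    induction ts with
    | nil => exact fun _ _ => id
    | cons t ts ih =>
      intro q s hq
      refine ih _ _ ?_
      rw [program_act]
      unfold act
      split
      · exact hq
      · split_ifs <;> exact hq
      · dsimp only
        split <;> exact hq
  rw [length_eq_one_of_foldl_clear (hq _ _ _ rfl) h hval] at h2
  obtain ⟨φ, rfl⟩ := List.length_eq_one_iff.1 h2.symm
  refine ⟨φ, h1 φ (by simp), ?_⟩
  simp [program] at h3
  simp [← h3, Function.comp_def]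

theorem initial_nodes (huntl : Operator.untl ∉ Op) {φ : LTL A} (hφ : φ.InFragment Op) :
    ∃ f b, initial Op (nodes φ).reverse =
      (⟨true, .eval none true, some b, false, .neg⟩, cellsOf f φ) := by
  refine ⟨fun ψ => some (step none (prev true fun _ => none) ψ),
    step none (prev true fun _ => none) φ, ?_⟩
  rw [initial, List.map_reverse, List.reverse_reverse]
  exact (congrArg _ (congrArg _ (map_cell_nodes φ))).trans
    (pass_cellsOf huntl hφ true none true false .neg _)

/-! ### The sweep from right to left -/

theorem scan_idle {q : State A} (hq : q.task = .idle) (ts : List (Cell A)) :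
    (program Op).scan q [] ts = (q, [], ts) := by
  induction ts with
  | nil => rfl
  | cons t ts ih =>
    have : ∀ t x y, act Op q t x y = (q, t, x, y, none) := by simp [act, hq]
    simp [SweepProgram.scan, this, ih]

theorem round_of_idle {m : Bool} {q : State A} {x : InputSymbol A} (h : (start m q x).task = .idle)
    (ts : List (Cell A)) : (program Op).round m (q, ts) x = (start m q x, ts) := by
  simp [SweepProgram.round, SweepProgram.pass, scan_idle h]

theorem round_letter (huntl : Operator.untl ∉ Op) {φ : LTL A} (hφ : φ.InFragment Op)
    (q : State A) (f : LTL A → Option Bool) (a : A) :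
    (program Op).round false (q, cellsOf f φ) (.letter a) =
      (⟨q.ok && q.val.isSome && decide (q.phase ≠ .bits), .eval (some a) !q.pending,
        some (step (some a) (prev (!q.pending) f) φ), true, q.phase⟩,
        cellsOf (fun ψ => some (step (some a) (prev (!q.pending) f) ψ)) φ) :=
  pass_cellsOf huntl hφ _ _ _ _ _ _

theorem cellsOf_congr {φ : LTL A} {f g : LTL A → Option Bool} {Op : Set Operator}
    (hφ : φ.InFragment Op) (h : ∀ ψ : LTL A, ψ.InFragment Op → f ψ = g ψ) :
    cellsOf f φ = cellsOf g φ := by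
  induction φ with
  | top | bot | letter c | negLetter c => simp [cellsOf, h _ hφ]
  | and φ ψ ih1 ih2 | or φ ψ ih1 ih2 => simp [cellsOf, h _ hφ, ih1 hφ.2.1, ih2 hφ.2.2]
  | next φ ih | eventually φ ih | globally φ ih => simp [cellsOf, h _ hφ, ih hφ.2]
  | untl φ ψ => rfl

/-- Reading a letter in front of the word `w`. -/
theorem round_letter_truthAt (huntl : Operator.untl ∉ Op) {φ : LTL A} (hφ : φ.InFragment Op)
    {q : State A} {f : LTL A → Option Bool} {w : List A} (hq : q.pending = !w.isEmpty)
    (hw : w ≠ [] → f = truthAt w) (a : A) :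
    (program Op).round false (q, cellsOf f φ) (.letter a) =
      (⟨q.ok && q.val.isSome && decide (q.phase ≠ .bits), .eval (some a) !q.pending,
        truthAt (a :: w) φ, true, q.phase⟩, cellsOf (truthAt (a :: w)) φ) := by
  have hprev : prev (!q.pending) f = truthAt w := by
    cases w with
    | nil => simp [prev, hq, truthAt_nil]
    | cons b w => simp [prev, hq, hw]
  rw [round_letter huntl hφ, hprev, step_truthAt huntl hφ]
  exact congrArg _ (cellsOf_congr hφ fun ψ hψ => step_truthAt huntl hψ a w)

/-- The words of a list, each preceded by `mark`. -/
def encodeWords (mark : InputSymbol A) (l : List (List A)) : List (InputSymbol A) :=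
  l.flatMap fun w => mark :: w.map InputSymbol.letter

theorem encode_eq (S : Sample A) (k : ℕ) :
    S.encode k = k.bits.map InputSymbol.bit ++
      (encodeWords .posMark S.pos ++ encodeWords .negMark S.neg) := by
  simp [Sample.encode, encodeWords]

/-- The control state and the cells after the sweep over `x`. -/
noncomputable def sweep (Op : Set Operator) (φ : LTL A) (x : List (InputSymbol A)) :
    State A × List (Cell A) :=
  (program Op).sweep x (nodes φ).reverse

theorem sweep_cons (φ : LTL A) (s : InputSymbol A) (x : List (InputSymbol A)) :
    sweep Op φ (s :: x) = (program Op).round false (sweep Op φ x) s := rfl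

/-- If no error has been found in `x`, then `x` is the end of the code of a sample, with respect
to which `φ` gives the right answers. -/
theorem exists_of_sweep (huntl : Operator.untl ∉ Op) {φ : LTL A} (hφ : φ.InFragment Op)
    {x : List (InputSymbol A)} (h : (sweep Op φ x).1.ok = true) :
    ∃ (bs : List (InputSymbol A)) (w : List A) (S : Sample A) (f : LTL A → Option Bool),
      x = bs ++ (w.map InputSymbol.letter ++
        (encodeWords .posMark S.pos ++ encodeWords .negMark S.neg)) ∧
      S.Separates φ ∧ (sweep Op φ x).2 = cellsOf f φ ∧
      (sweep Op φ x).1.pending = (!w.isEmpty) ∧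
      (w ≠ [] → f = truthAt w ∧ (sweep Op φ x).1.val = truthAt w φ) ∧
      ((sweep Op φ x).1.phase = .neg → S.pos = []) ∧
      (if (sweep Op φ x).1.phase = .bits
        then w = [] ∧ ∃ k : ℕ, k ≠ 0 ∧ bs = k.bits.map InputSymbol.bit
        else bs = []) := by
  induction x with
  | nil =>
    obtain ⟨f, b, hinit⟩ := initial_nodes huntl hφ
    have : sweep Op φ [] = _ := hinit
    rw [this]
    exact ⟨[], [], ⟨[], [], by simp, by simp⟩, f, by simp [encodeWords], by simp [Sample.Separates],
      by simp⟩
  | cons s x ih =>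
    rw [sweep_cons] at h ⊢
    obtain ⟨bs, w, S, f, hx, hS, hcells, hpend, hw, hneg, hphase⟩ := ih (ok_of_round h).1
    generalize sweep Op φ x = c at h hcells hpend hw hneg hphase ⊢
    obtain ⟨⟨ok, task, val, pending, phase⟩, ts⟩ := c
    dsimp only at hcells hpend hw hneg hphase
    subst hcells
    cases s with
    | letter a =>
      rw [round_letter_truthAt huntl hφ hpend (fun h => (hw h).1)] at h ⊢
      simp only [Bool.and_eq_true, decide_eq_true_eq] at h
      rw [if_neg h.2] at hphase
      subst hphase
      refine ⟨[], a :: w, S, _, by simp [hx], hS, rfl, by simp, fun _ => ⟨rfl, rfl⟩, hneg, ?_⟩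
      simp [h.2]
    | negMark =>
      rw [round_of_idle rfl] at h ⊢
      simp only [start, Bool.and_eq_true, decide_eq_true_eq] at h
      obtain ⟨⟨⟨-, hp⟩, hv⟩, rfl⟩ := h
      have hne : w ≠ [] := by
        rintro rfl
        simp [hp] at hpend
      rw [if_neg (by simp)] at hphase
      subst hphase
      have hval := (hw hne).2
      rw [hv, truthAt_of_ne_nil hne] at hval
      refine ⟨[], [], ⟨[], w :: S.neg, by simp, by simpa using ⟨hne, S.neg_ne_nil⟩⟩, f, ?_, ?_, rfl,
        rfl, by simp, by simp [start], by simp [start]⟩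
      · simp [hx, hneg rfl, encodeWords]
      · refine ⟨by simp, ?_⟩
        rw [List.forall_mem_cons]
        exact ⟨by simpa using hval.symm, hS.2⟩
    | posMark =>
      rw [round_of_idle rfl] at h ⊢
      simp only [start, Bool.and_eq_true, decide_eq_true_eq] at h
      obtain ⟨⟨⟨-, hp⟩, hv⟩, hb⟩ := h
      have hne : w ≠ [] := by
        rintro rfl
        simp [hp] at hpend
      rw [if_neg hb] at hphase
      subst hphase
      have hval := (hw hne).2
      rw [hv, truthAt_of_ne_nil hne] at hval
      refine ⟨[], [], ⟨w :: S.pos, S.neg, by simpa using ⟨hne, S.pos_ne_nil⟩, S.neg_ne_nil⟩, f, ?_,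
        ?_, rfl, rfl, by simp, by simp [start], by simp [start]⟩
      · simp [hx, encodeWords]
      · refine ⟨?_, hS.2⟩
        rw [List.forall_mem_cons]
        exact ⟨by simpa using hval.symm, hS.1⟩
    | bit b =>
      rw [round_of_idle rfl] at h ⊢
      simp only [start, Bool.and_eq_true, Bool.or_eq_true, decide_eq_true_eq,
        Bool.not_eq_true'] at h
      obtain ⟨⟨-, rfl⟩, hb⟩ := h
      have hnil : w = [] := by simpa using hpend.symm
      subst hnil
      refine ⟨.bit b :: bs, [], S, f, by simp [hx], hS, rfl, rfl, by simp, by simp [start], ?_⟩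
      simp only [start, if_true]
      refine ⟨trivial, ?_⟩
      split_ifs at hphase with hbits
      · obtain ⟨-, k, hk, rfl⟩ := hphase
        refine ⟨Nat.bit b k, by simp [Nat.bit_eq_zero_iff, hk], ?_⟩
        rw [Nat.bits_append_bit _ _ (fun h => absurd h hk)]
        rfl
      · rw [or_iff_left hbits] at hb
        subst hb hphase
        exact ⟨1, by simp, by simp⟩

/-- The sweep finds no error in a word in front of an input in which it has found none. -/
theorem sweep_letters (huntl : Operator.untl ∉ Op) {φ : LTL A} (hφ : φ.InFragment Op)
    {x : List (InputSymbol A)} {task : Task A} {val : Option Bool} {phase : Phase}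
    {f : LTL A → Option Bool} (hval : val.isSome = true) (hphase : phase ≠ .bits)
    (h : sweep Op φ x = (⟨true, task, val, false, phase⟩, cellsOf f φ)) {w : List A}
    (hw : w ≠ []) :
    ∃ task, sweep Op φ (w.map InputSymbol.letter ++ x) =
      (⟨true, task, truthAt w φ, true, phase⟩, cellsOf (truthAt w) φ) := by
  induction w with
  | nil => exact absurd rfl hw
  | cons a w ih =>
    rw [List.map_cons, List.cons_append, sweep_cons]
    by_cases hnil : w = []
    · subst hnil
      rw [List.map_nil, List.nil_append, h,
        round_letter_truthAt huntl hφ (w := []) rfl (by simp)]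
      exact ⟨.eval (some a) true, by simp [hval, hphase]⟩
    · obtain ⟨task', h'⟩ := ih hnil
      rw [h', round_letter_truthAt huntl hφ (w := w) (by simp [hnil]) (fun _ => rfl)]
      exact ⟨.eval (some a) false, by simp [hphase, truthAt_of_ne_nil hnil]⟩

theorem sweep_encodeWords_neg (huntl : Operator.untl ∉ Op) {φ : LTL A} (hφ : φ.InFragment Op)
    {l : List (List A)} (hne : ∀ v ∈ l, v ≠ []) (hl : ∀ v ∈ l, ¬ φ.Sat v) :
    ∃ task b f, sweep Op φ (encodeWords .negMark l) =
      (⟨true, task, some b, false, .neg⟩, cellsOf f φ) := by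
  induction l with
  | nil =>
    obtain ⟨f, b, hinit⟩ := initial_nodes huntl hφ
    exact ⟨_, b, f, hinit⟩
  | cons v l ih =>
    rw [List.forall_mem_cons] at hne hl
    obtain ⟨task, b, f, h⟩ := ih hne.2 hl.2
    obtain ⟨task', h'⟩ := sweep_letters huntl hφ rfl (by simp) h hne.1
    refine ⟨.idle, false, truthAt v, ?_⟩
    rw [encodeWords, List.flatMap_cons, List.cons_append, sweep_cons]
    refine (congrArg (fun c => (program Op).round false c _) h').trans ?_
    rw [round_of_idle rfl]
    simp [start, truthAt_of_ne_nil hne.1, hl.1]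

theorem sweep_encodeWords (huntl : Operator.untl ∉ Op) {φ : LTL A} (hφ : φ.InFragment Op)
    {S : Sample A} (hS : S.Separates φ) :
    ∃ task b f phase, phase ≠ .bits ∧
      sweep Op φ (encodeWords .posMark S.pos ++ encodeWords .negMark S.neg) =
      (⟨true, task, some b, false, phase⟩, cellsOf f φ) := by
  obtain ⟨U, V, hU, hV⟩ := S
  obtain ⟨hS1, hS2⟩ := hS
  simp only at hS1 hS2 ⊢
  induction U with
  | nil =>
    obtain ⟨task, b, f, h⟩ := sweep_encodeWords_neg huntl hφ hV hS2
    exact ⟨task, b, f, .neg, by simp, by simpa [encodeWords] using h⟩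
  | cons u U ih =>
    rw [List.forall_mem_cons] at hU hS1
    obtain ⟨task, b, f, phase, hphase, h⟩ := ih hU.2 hS1.2
    obtain ⟨task', h'⟩ := sweep_letters huntl hφ rfl hphase h hU.1
    refine ⟨.idle, true, truthAt u, .pos, by simp, ?_⟩
    rw [encodeWords, List.flatMap_cons, List.append_assoc, List.cons_append, sweep_cons]
    refine (congrArg (fun c => (program Op).round false c _) h').trans ?_
    rw [round_of_idle rfl]
    simp [start, truthAt_of_ne_nil hU.1, hS1.1, hphase]

theorem sweep_encode (huntl : Operator.untl ∉ Op) {φ : LTL A} (hφ : φ.InFragment Op)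
    {S : Sample A} (hS : S.Separates φ) (k : ℕ) :
    ∃ task b f phase, (k ≠ 0 → phase = .bits) ∧ sweep Op φ (S.encode k) =
      (⟨true, task, some b, false, phase⟩, cellsOf f φ) := by
  rw [encode_eq]
  induction k using Nat.binaryRec' with
  | zero =>
    obtain ⟨task, b, f, phase, -, h⟩ := sweep_encodeWords huntl hφ hS
    exact ⟨task, b, f, phase, by simp, by simpa using h⟩
  | bit b k hk ih =>
    obtain ⟨task, b', f, phase, hphase, h⟩ := ih
    refine ⟨.idle, b', f, .bits, fun _ => rfl, ?_⟩
    rw [Nat.bits_append_bit _ _ hk, List.map_cons, List.cons_append, sweep_cons, h,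
      round_of_idle rfl]
    have : b = true ∨ phase = .bits := by
      by_cases h0 : k = 0
      exacts [Or.inl (hk h0), Or.inr (hphase h0)]
    simpa [start] using this

/-! ### The sweep from left to right -/

/-- The number of marked cells. -/
def marked (ts : List (Cell A)) : ℕ := ts.countP fun t => t.2.2

/-- Of the marked cells, every second one remains marked. -/
theorem scan_halve {q : State A} {b : Bool} (hq : q.task = .halve b) (ts : List (Cell A)) :
    ((program Op).scan q [] ts).1.ok = q.ok ∧ ((program Op).scan q [] ts).2.1 = [] ∧
      marked ((program Op).scan q [] ts).2.2 = (marked ts + 1 - b.toNat) / 2 := by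
  induction ts generalizing q b with
  | nil => cases b <;> simp [SweepProgram.scan, marked]
  | cons t ts ih =>
    obtain ⟨tok, ann, alive⟩ := t
    cases alive with
    | false =>
      have hact : act Op q (tok, ann, false) none none =
          (q, (tok, ann, false), none, none, none) := by
        simp [act, hq]
      simpa [SweepProgram.scan, hact, marked] using ih hq
    | true =>
      have hact : act Op q (tok, ann, true) none none =
          ({ q with task := .halve !b }, (tok, ann, !b), none, none, none) := by
        simp [act, hq]
      obtain ⟨h1, h2, h3⟩ := ih (q := { q with task := .halve !b }) rfl
      simp only [marked] at h3
      simp only [SweepProgram.scan, program_act, List.head?_nil, List.tail_nil, hact,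
        Option.toList_none, List.nil_append, marked, List.countP_cons, h3]
      refine ⟨h1, h2, ?_⟩
      cases b <;> simp
      omega

/-- The number whose binary digits, the least significant one first, are the bits among the
symbols of `x`. -/
def bitsValue : List (InputSymbol A) → ℕ
  | [] => 0
  | .bit b :: x => 2 * bitsValue x + b.toNat
  | _ :: x => bitsValue x

/-- The second sweep compares the number `n` of marked cells with the number `k` given by the bits:
`n ≤ 2 k + b` if and only if `⌈(n - b) / 2⌉ ≤ k`. -/
theorem foldl_round_true (x : List (InputSymbol A)) (c : State A × List (Cell A)) :
    (x.foldl ((program Op).round true) c).1.ok = c.1.ok ∧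
      (marked (x.foldl ((program Op).round true) c).2 = 0 ↔ marked c.2 ≤ bitsValue x) := by
  induction x generalizing c with
  | nil => simp [bitsValue]
  | cons s x ih =>
    rw [List.foldl_cons]
    refine ⟨(ih _).1.trans ?_, (ih _).2.trans ?_⟩
    · cases s with
      | bit b =>
        obtain ⟨h1, h2, -⟩ := scan_halve (Op := Op) (q := start true c.1 (.bit b)) rfl c.2
        simp only [SweepProgram.round, SweepProgram.pass, program_start, h2, h1, List.foldl_nil]
        rfl
      | posMark | negMark | letter a =>
        rw [show c = (c.1, c.2) from rfl, round_of_idle rfl]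
        rfl
    · cases s with
      | bit b =>
        obtain ⟨-, -, h3⟩ := scan_halve (Op := Op) (q := start true c.1 (.bit b)) rfl c.2
        simp only [SweepProgram.round, SweepProgram.pass, program_start, h3, bitsValue]
        cases b <;> simp only [Bool.toNat_true, Bool.toNat_false] <;> omega
      | posMark | negMark | letter a =>
        rw [show c = (c.1, c.2) from rfl, round_of_idle rfl]
        rfl

theorem bitsValue_encode (S : Sample A) (k : ℕ) : bitsValue (S.encode k) = k := by
  have hletters : ∀ (w : List A) (x : List (InputSymbol A)),
      bitsValue (w.map InputSymbol.letter ++ x) = bitsValue x := by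
    intro w x
    induction w with
    | nil => rfl
    | cons a w ih => exact ih
  have hwords : ∀ (mark : InputSymbol A), (∀ b, mark ≠ .bit b) → ∀ (l : List (List A))
      (x : List (InputSymbol A)), bitsValue (encodeWords mark l ++ x) = bitsValue x := by
    intro mark hmark l x
    induction l with
    | nil => rfl
    | cons w l ih =>
      rw [encodeWords, List.flatMap_cons, List.append_assoc, List.cons_append]
      refine Eq.trans ?_ ((hletters w _).trans ih)
      cases mark with
      | bit b => exact absurd rfl (hmark b)
      | posMark | negMark | letter a => rfl
  rw [encode_eq]
  induction k using Nat.binaryRec' with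
  | zero =>
    have h := hwords .negMark (by simp) S.neg []
    rw [List.append_nil] at h
    exact (hwords .posMark (by simp) S.pos _).trans h
  | bit b k hk ih =>
    rw [Nat.bits_append_bit _ _ hk, List.map_cons, List.cons_append, bitsValue, ih, Nat.bit_val]

theorem ok_foldl_drain (q : State A) (ts : List (Cell A)) :
    (ts.foldl (program Op).drain q).ok = true ↔ q.ok = true ∧ marked ts = 0 := by
  induction ts generalizing q with
  | nil => simp [marked]
  | cons t ts ih =>
    rw [List.foldl_cons, ih]
    simp [program, marked, List.countP_cons]
    tauto

/-! ### Correctness of the verifier -/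

/-- The verifier accepts exactly the pairs of an instance and a solution in prefix order. -/
theorem verify_eq_true (huntl : Operator.untl ∉ Op) {x : List (InputSymbol A)}
    {y : List (Token A)} :
    (program Op).verify (x, y) = true ↔
      ∃ φ : LTL A, φ.InFragment Op ∧ y = (nodes φ).reverse ∧ ∃ (S : Sample A) (k : ℕ),
        x = S.encode k ∧ φ.size ≤ k ∧ S.Separates φ := by
  have hverify : (program Op).verify (x, y) = true ↔
      ((((program Op).sweep x y).1.ok = true ∧ ((program Op).sweep x y).1.val.isSome = true) ∧
        ((program Op).sweep x y).1.pending = false) ∧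
      marked ((program Op).sweep x y).2 ≤ bitsValue x := by
    refine (ok_foldl_drain _ _).trans ?_
    rw [(foldl_round_true _ _).1, (foldl_round_true _ _).2]
    simp [program]
  rw [hverify]
  constructor
  · rintro ⟨⟨⟨hok, hval⟩, hpend⟩, hmarked⟩
    obtain ⟨h1, h2⟩ : (initial Op y).1.ok = true ∧ (initial Op y).1.val.isSome = true := by
      have : ∀ x, ((program Op).sweep x y).1.ok = true →
          ((program Op).sweep x y).1.val.isSome = true →
          (initial Op y).1.ok = true ∧ (initial Op y).1.val.isSome = true := by
        intro x
        induction x with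
        | nil => exact fun h1 h2 => ⟨h1, h2⟩
        | cons s x ih => exact fun h1 _ => ih (ok_of_round h1).1 (ok_of_round h1).2
      exact this x hok hval
    obtain ⟨φ, hφ, rfl⟩ := exists_nodes_of_initial h1 h2
    obtain ⟨bs, w, S, f, hx, hS, hcells, hw, -, -, hphase⟩ := exists_of_sweep huntl hφ hok
    have hnil : w = [] := by simpa using hw.symm.trans hpend
    subst hnil
    obtain ⟨k, hk⟩ : ∃ k : ℕ, bs = k.bits.map InputSymbol.bit := by
      split_ifs at hphase
      · exact ⟨hphase.2.choose, hphase.2.choose_spec.2⟩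
      · exact ⟨0, by simpa using hphase⟩
    have hx' : x = S.encode k := by rw [hx, encode_eq, hk]; rfl
    refine ⟨φ, hφ, rfl, S, k, hx', ?_, hS⟩
    rw [hx', bitsValue_encode, ← hx'] at hmarked
    have hcount : marked ((program Op).sweep x (nodes φ).reverse).2 = φ.size :=
      (congrArg marked hcells).trans (countP_cellsOf huntl hφ f)
    omega
  · rintro ⟨φ, hφ, rfl, S, k, rfl, hsize, hS⟩
    obtain ⟨task, b, f, phase, -, h⟩ := sweep_encode huntl hφ hS k
    rw [sweep] at h
    rw [h, bitsValue_encode]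
    exact ⟨by simp, (countP_cellsOf huntl hφ f).trans_le hsize⟩

/-! ### Finiteness of the alphabets and of the set of control states -/

instance [Finite A] : Finite (InputSymbol A) := by
  let f : InputSymbol A → Option Bool ⊕ Option A
    | .bit b => .inl (some b)
    | .posMark => .inl none
    | .negMark => .inr none
    | .letter a => .inr (some a)
  refine Finite.of_injective f ?_
  rintro (_ | _ | _ | _) (_ | _ | _ | _) h <;> simp_all [f]

instance [Finite A] : Finite (Token A) := by
  let f : Token A → A ⊕ A ⊕ Fin 7
    | .letter c => .inl c
    | .negLetter c => .inr (.inl c)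
    | .top => .inr (.inr 0)
    | .bot => .inr (.inr 1)
    | .and => .inr (.inr 2)
    | .or => .inr (.inr 3)
    | .next => .inr (.inr 4)
    | .eventually => .inr (.inr 5)
    | .globally => .inr (.inr 6)
  refine Finite.of_injective f ?_
  rintro (_ | _ | _ | _ | _ | _ | _ | _ | _) (_ | _ | _ | _ | _ | _ | _ | _ | _) h <;>
    simp_all [f]

instance [Finite A] : Finite (Task A) := by
  let f : Task A → (Option A × Bool) ⊕ Option Bool
    | .eval a last => .inl (a, last)
    | .halve b => .inr (some b)
    | .idle => .inr none
  refine Finite.of_injective f ?_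
  rintro (_ | _ | _) (_ | _ | _) h <;> simp_all [f]

instance : Finite Phase := by
  refine Finite.of_injective (fun p : Phase => (decide (p = .neg), decide (p = .pos))) ?_
  rintro (_ | _ | _) (_ | _ | _) h <;> simp_all

instance [Finite A] : Finite (State A) :=
  Finite.of_injective
    (fun q : State A => (q.ok, q.task, q.val, q.pending, q.phase)) (by
      rintro ⟨⟩ ⟨⟩ h
      simpa using h)

instance : Inhabited (InputSymbol A) := ⟨.posMark⟩

instance : Inhabited (Token A) := ⟨.top⟩

end Verifier

theorem Sample.size_le_length_encode {A : Type} (S : Sample A) (k : ℕ) :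
    S.size ≤ (S.encode k).length := by
  have h : ∀ (mark : InputSymbol A) (l : List (List A)),
      (l.map List.length).sum ≤ (Verifier.encodeWords mark l).length := by
    intro mark l
    induction l with
    | nil => simp
    | cons w l ih =>
      simp only [Verifier.encodeWords, List.map_cons, List.sum_cons, List.flatMap_cons,
        List.length_append, List.length_cons, List.length_map] at ih ⊢
      omega
  have h1 := h .posMark S.pos
  have h2 := h .negMark S.neg
  rw [Verifier.encode_eq, size]
  simp only [List.length_append]
  omega

theorem inNP_learningProblem {A : Type} [Finite A] {Op : Set Operator}
    (huntl : Operator.untl ∉ Op) : InNP (learningProblem A Op) := by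
  refine InNP.of_sweepProgram (Verifier.program Op) ((Polynomial.X + 10) ^ 6) fun x => ?_
  simp only [Verifier.verify_eq_true huntl]
  constructor
  · rintro ⟨S, k, rfl, φ, hφ, hsize, hS⟩
    -- The smaller one of `φ` and a short separating formula meets both bounds.
    obtain ⟨ψ, h1, h2, h3⟩ := LTL.exists_short_separating huntl hφ hS
    have hlen : (S.size + 10) ^ 6 ≤ ((Polynomial.X + 10) ^ 6 : Polynomial ℕ).eval
        (S.encode k).length := by
      simpa using Nat.pow_le_pow_left (Nat.add_le_add_right (S.size_le_length_encode k) 10) 6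
    rcases le_total φ.size ψ.size with h | h
    · refine ⟨_, ?_, φ, hφ, rfl, S, k, rfl, hsize, hS⟩
      rw [List.length_reverse, Verifier.length_nodes huntl hφ]
      exact (h.trans h3).trans hlen
    · refine ⟨_, ?_, ψ, h1, rfl, S, k, rfl, h.trans hsize, h2⟩
      rw [List.length_reverse, Verifier.length_nodes huntl h1]
      exact h3.trans hlen
  · rintro ⟨y, -, φ, hφ, -, S, k, hx, hsize, hS⟩
    exact ⟨S, k, hx, φ, hφ, hsize, hS⟩

theorem mainTheorem6 (Op : Set Operator)
    (hOp : Op ⊆ {Operator.eventually, Operator.globally, Operator.next,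
      Operator.and, Operator.or}) :
    ShortFormulaProperty Op ∧
      ∀ (A : Type) [Finite A], InNP (learningProblem A Op) := by
  have huntl : Operator.untl ∉ Op := fun h => by simpa using hOp h
  exact ⟨shortFormulaProperty huntl, fun A _ => inNP_learningProblem huntl⟩
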